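/- Let $\mathbb K$ be a Hausdorff, non-discrete topological field. All topological $\mathbb K$-vector spaces are Hausdorff. Let $E,F$ be topological $\mathbb K$-vector spaces, $U\subseteq E$ open and $f\colon U\to F$ a map. Put $U^{[1]}=\{(x,y,t)\in U\times E\times\mathbb K : x+ty\in U\}$. The map $f$ is $C^0$ if it is continuous; it is $C^{k+1}$ if it is continuous and there is a continuous map $f^{[1]}\colon U^{[1]}\to F$ that is $C^k$ and satisfies $f^{[1]}(x,y,t)=t^{-1}(f(x+ty)-f(x))$ whenever $t\neq0$; it is $C^\infty$ if it is $C^k$ for all $k\in\mathbb N$. Smooth manifolds and Lie groups modelled on topological $\mathbb K$-vector spaces, and $C^k$-maps between them, are defined by means of charts, as usual (manifolds have $C^\infty$-atlases, and the operations of a Lie group are $C^\infty$). A continuous map $f\colon U\to F$ is *feebly differentiable* at $x\in U$ if there is a continuous linear map $f'(x)\colon E\to F$ such that the map $$(y,t)\mapsto\begin{cases} t^{-1}(f(x+ty)-f(x)) & (t\ne0)\\ f'(x)y & (t=0)\end{cases}$$ is continuous on $\{(y,t)\in E\times\mathbb K^\times : x+ty\in U\}\cup(E\times\{0\})$. If $\mathbb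 K$ is a valued field (a field with a non-trivial real-valued absolute value, with the topology it defines), a map $f\colon U\to F$ on a neighbourhood $U$ of $x$ is *totally differentiable* at $x$ if there is a continuous linear map $f'(x)\colon E\to F$ such that, with $h(y)=f(x+y)-f(x)-f'(x)y$, for every $0$-neighbourhood $W\subseteq F$ there are a $0$-neighbourhood $V\subseteq E$ and a function $\theta\colon I\to\mathbb K$ on a $0$-neighbourhood $I\subseteq\mathbb K$ with $I\cdot V\subseteq U-x$, $\theta(0)=0$, $\lim_{t\to0}\theta(t)/t=0$ and $h(tV)\subseteq\theta(t)W$ for all $t\in I$. A map between smooth manifolds is feebly (resp. totally) differentiable at a point if it is continuous there and, for some charts $\varphi\colon U_1\to U$ around the point and $\psi\colon V_1\to V$ around its image, the map $\psi\circ f\circ\varphi^{-1}$ on $\varphi(f^{-1}(V_1)\cap U_1)$ is so at the corresponding point. **Lemma.** Let $f\colon G\to H$ be a homomorphism between Lie groups modelled on topological vector spaces over $\mathbb K$. 1. If $f$ is feebly differentiable at $1$, then $f$ is $C^1_{\mathbb K}$. 2. If $\mathbb K$ is a valued field and $f$ is totally differentiable at $1$, then $f$ is feebly differentiable at $1$;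 hence $f$ is $C^1_{\mathbb K}$. 3. If $\mathbb K\in\{\mathbb R,\mathbb C\}$, the modelling space of $H$ is locally convex, and $f$ is feebly differentiable (or totally differentiable) at $1$, then $f$ is $C^\infty_{\mathbb K}$. -/

import Mathlib

open Set Filter Topology

namespace TVSLie

/-! ### `C^k`-maps between topological vector spaces over a topological field -/

section Calculus

universe u v w

/-- The set `U^[1] = {(x, y, t) : x ∈ U and x + t y ∈ U}`. -/
def domOne (K : Type w) {E : Type u} [Field K] [AddCommGroup E] [Module K E] (U : Set E) :
    Set (E × E × K) :=
  {p | p.1 ∈ U ∧ p.1 + p.2.2 • p.2.1 ∈ U}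

/-- `g` is a continuous extension of the difference quotient of `f` to `U^[1]`: it is continuous
there, and `g (x, y, t) = t⁻¹ (f (x + t y) - f x)` at all points of `U^[1]` with `t ≠ 0`. -/
def IsDiffQuotient {K : Type w} {E : Type u} {F : Type v} [Field K] [TopologicalSpace K]
    [AddCommGroup E] [Module K E] [TopologicalSpace E]
    [AddCommGroup F] [Module K F] [TopologicalSpace F]
    (U : Set E) (f : E → F) (g : E × E × K → F) : Prop :=
  ContinuousOn g (domOne K U) ∧
    ∀ x y : E, ∀ t : K, (x, y, t) ∈ domOne K U → t ≠ 0 →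
      g (x, y, t) = t⁻¹ • (f (x + t • y) - f x)

/-- The recursion defining `C^k`-maps on an open set `U`, for domains whose universe is at least
that of the field (so that `E × E × K` lies in the same universe as `E`).
The general notion is `IsCkOn` below. -/
def IsCkOnAux (K : Type w) [Field K] [TopologicalSpace K]
    {F : Type v} [AddCommGroup F] [Module K F] [TopologicalSpace F] :
    ℕ → ∀ (E : Type (max u w)) [AddCommGroup E] [Module K E] [TopologicalSpace E],
      Set E → (E → F) → Prop
  | 0, _, _, _, _, U, f => ContinuousOn f U
  | n + 1, E, _, _, _, U, f => ContinuousOn f U ∧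
      ∃ g : E × E × K → F, IsDiffQuotient U f g ∧ IsCkOnAux K n (E × E × K) (domOne K U) g

/-- `f` is `C^k` on the open set `U`: it is continuous on `U` and, if `k = n + 1`, there is a
continuous map `f^[1]` on `U^[1]` extending the difference quotient, and `f^[1]` is `C^n`.
The values of `f` outside `U` play no role. See `isCkOn_zero` and `isCkOn_succ`. -/
def IsCkOn (K : Type w) {E : Type u} {F : Type v} [Field K] [TopologicalSpace K]
    [AddCommGroup E] [Module K E] [TopologicalSpace E]
    [AddCommGroup F] [Module K F] [TopologicalSpace F] (k : ℕ) (U : Set E) (f : E → F) : Prop :=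
  match k with
  | 0 => ContinuousOn f U
  | n + 1 => ContinuousOn f U ∧
      ∃ g : E × E × K → F, IsDiffQuotient U f g ∧
        IsCkOnAux.{u, v, w} K n (E × E × K) (domOne K U) g

theorem isCkOn_zero (K : Type w) {E : Type u} {F : Type v} [Field K] [TopologicalSpace K]
    [AddCommGroup E] [Module K E] [TopologicalSpace E]
    [AddCommGroup F] [Module K F] [TopologicalSpace F] (U : Set E) (f : E → F) :
    IsCkOn K 0 U f ↔ ContinuousOn f U := Iff.rfl

theorem isCkOnAux_iff (K : Type w) [Field K] [TopologicalSpace K]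
    {F : Type v} [AddCommGroup F] [Module K F] [TopologicalSpace F] (n : ℕ) :
    ∀ (E : Type (max u w)) [AddCommGroup E] [Module K E] [TopologicalSpace E]
      (U : Set E) (f : E → F), IsCkOnAux.{u, v, w} K n E U f ↔ IsCkOn.{max u w, v, w} K n U f := by
  have h : ∀ (m : ℕ) (E : Type (max u w)) [AddCommGroup E] [Module K E] [TopologicalSpace E]
      (U : Set E) (f : E → F),
      IsCkOnAux.{u, v, w} K m E U f ↔ IsCkOnAux.{max u w, v, w} K m E U f := by
    intro m
    induction m with
    | zero => intro E _ _ _ U f; exact Iff.rfl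
    | succ m ih => intro E _ _ _ U f; simp only [IsCkOnAux, ih]
  intro E _ _ _ U f
  cases n with
  | zero => exact Iff.rfl
  | succ n => simp only [IsCkOnAux, IsCkOn, h]

/-- The recursive characterization of `C^(n+1)`-maps, in all universes. -/
theorem isCkOn_succ (K : Type w) {E : Type u} {F : Type v} [Field K] [TopologicalSpace K]
    [AddCommGroup E] [Module K E] [TopologicalSpace E]
    [AddCommGroup F] [Module K F] [TopologicalSpace F] (n : ℕ) (U : Set E) (f : E → F) :
    IsCkOn K (n + 1) U f ↔ ContinuousOn f U ∧
      ∃ g : E × E × K → F, IsDiffQuotient U f g ∧ IsCkOn K n (domOne K U) g := by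
  exact and_congr_right fun _ => exists_congr fun g => and_congr_right fun _ =>
    isCkOnAux_iff.{u, v, w} K n _ _ _

/-- Feeble differentiability at `x` of a continuous map `f` on an open set `U`: there is a
continuous linear map `L` such that the map `g` which sends `(y, t)` to
`t⁻¹ (f (x + t y) - f x)` if `t ≠ 0`, and to `L y` if `t = 0`,
is continuous on `{(y, t) : t ≠ 0, x + t y ∈ U} ∪ {(y, 0)}`. -/
def FeeblyDifferentiableAt (K : Type w) {E : Type u} {F : Type v} [Field K] [TopologicalSpace K]
    [AddCommGroup E] [Module K E] [TopologicalSpace E]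
    [AddCommGroup F] [Module K F] [TopologicalSpace F] (U : Set E) (f : E → F) (x : E) : Prop :=
  IsOpen U ∧ x ∈ U ∧ ContinuousOn f U ∧
    ∃ L : E →L[K] F,
      ∃ g : E × K → F,
        (∀ y : E, ∀ t : K, t ≠ 0 → x + t • y ∈ U → g (y, t) = t⁻¹ • (f (x + t • y) - f x)) ∧
        (∀ y : E, g (y, 0) = L y) ∧
        ContinuousOn g {p | p.2 ≠ 0 ∧ x + p.2 • p.1 ∈ U ∨ p.2 = 0}

/-- Total differentiability at `x` of a map `f` defined on a neighbourhood `U` of `x`: there is a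
continuous linear map `L` such that `h y = f (x + y) - f x - L y` is tangent to `0`, i.e. for each
`0`-neighbourhood `W` there are a `0`-neighbourhood `V` and a function `θ` on a
`0`-neighbourhood `I` of the field such that `I V ⊆ U - x`, `θ t = o(t)` and `h (t V) ⊆ θ t W`
for all `t ∈ I`. -/
def TotallyDifferentiableAt (K : Type w) {E : Type u} {F : Type v} [Field K] [TopologicalSpace K]
    [AddCommGroup E] [Module K E] [TopologicalSpace E]
    [AddCommGroup F] [Module K F] [TopologicalSpace F] (U : Set E) (f : E → F) (x : E) : Prop :=
  U ∈ 𝓝 x ∧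
    ∃ L : E →L[K] F, ∀ W ∈ 𝓝 (0 : F), ∃ V ∈ 𝓝 (0 : E), ∃ I ∈ 𝓝 (0 : K), ∃ θ : K → K,
      (∀ t ∈ I, ∀ v ∈ V, x + t • v ∈ U) ∧
      θ 0 = 0 ∧ Tendsto (fun t => θ t / t) (𝓝[≠] 0) (𝓝 0) ∧
      ∀ t ∈ I, ∀ v ∈ V, ∃ w ∈ W, f (x + t • v) - f x - L (t • v) = θ t • w

end Calculus

/-! ### Manifolds and Lie groups modelled on topological vector spaces -/

section Manifolds

variable (K : Type*) [Field K] [TopologicalSpace K]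
  {E : Type*} [AddCommGroup E] [Module K E] [TopologicalSpace E]
  {F : Type*} [AddCommGroup F] [Module K F] [TopologicalSpace F]
  {M : Type*} [TopologicalSpace M] {N : Type*} [TopologicalSpace N]

/-- The set `φ (f⁻¹(V₁) ∩ U₁)` on which the local representative `ψ ∘ f ∘ φ⁻¹` of `f` is defined,
where `U₁` and `V₁` are the domains of the charts `φ` and `ψ`. -/
def repDomain {E F : Type*} [TopologicalSpace E] [TopologicalSpace F]
    (φ : OpenPartialHomeomorph M E) (ψ : OpenPartialHomeomorph N F) (f : M → N) : Set E :=
  φ '' (f ⁻¹' ψ.source ∩ φ.source)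

/-- The local representative of `f` in the charts `φ` and `ψ` is `C^∞`. -/
def IsSmoothIn (φ : OpenPartialHomeomorph M E) (ψ : OpenPartialHomeomorph N F) (f : M → N) :
    Prop :=
  ∀ k : ℕ, IsCkOn K k (repDomain φ ψ f) (ψ ∘ f ∘ φ.symm)

/-- `φ` is a chart of the smooth manifold `M`: it is `C^∞`-compatible with all charts of the given
atlas, i.e. it belongs to the maximal atlas. -/
def IsChart [ChartedSpace E M] (φ : OpenPartialHomeomorph M E) : Prop :=
  ∀ e ∈ atlas E M, IsSmoothIn K φ e id ∧ IsSmoothIn K e φ id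

/-- A Lie group over `K` modelled on the topological vector space `E`: a topological group with a
`C^∞`-atlas for which the group operations are `C^∞`, i.e. continuous and `C^∞` in charts. -/
class LieGroupOver (E : Type*) [AddCommGroup E] [Module K E] [TopologicalSpace E]
    (G : Type*) [Group G] [TopologicalSpace G] [ChartedSpace E G] : Prop
    extends IsTopologicalGroup G where
  compatible : ∀ e ∈ atlas E G, IsChart K e
  smooth_mul : ∀ φ₁ φ₂ ψ : OpenPartialHomeomorph G E, IsChart K φ₁ → IsChart K φ₂ → IsChart K ψ →
    IsSmoothIn K (φ₁.prod φ₂) ψ (fun p : G × G => p.1 * p.2)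
  smooth_inv : ∀ φ ψ : OpenPartialHomeomorph G E, IsChart K φ → IsChart K ψ →
    IsSmoothIn K φ ψ (fun x : G => x⁻¹)

/-- A map between manifolds is `C^k` if it is continuous and its local representatives in all
pairs of charts are `C^k`. -/
def IsCkMap (E : Type*) [AddCommGroup E] [Module K E] [TopologicalSpace E]
    (F : Type*) [AddCommGroup F] [Module K F] [TopologicalSpace F]
    [ChartedSpace E M] [ChartedSpace F N] (k : ℕ) (f : M → N) : Prop :=
  Continuous f ∧ ∀ (φ : OpenPartialHomeomorph M E) (ψ : OpenPartialHomeomorph N F),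
    IsChart K φ → IsChart K ψ → IsCkOn K k (repDomain φ ψ f) (ψ ∘ f ∘ φ.symm)

/-- A map between manifolds is feebly differentiable at `x` if it is continuous at `x` and some
local representative around `x` is feebly differentiable at the image of `x`. -/
def MFeeblyDifferentiableAt (E : Type*) [AddCommGroup E] [Module K E] [TopologicalSpace E]
    (F : Type*) [AddCommGroup F] [Module K F] [TopologicalSpace F]
    [ChartedSpace E M] [ChartedSpace F N] (f : M → N) (x : M) : Prop :=
  ContinuousAt f x ∧ ∃ (φ : OpenPartialHomeomorph M E) (ψ : OpenPartialHomeomorph N F),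
    IsChart K φ ∧ IsChart K ψ ∧ x ∈ φ.source ∧ f x ∈ ψ.source ∧
      FeeblyDifferentiableAt K (repDomain φ ψ f) (ψ ∘ f ∘ φ.symm) (φ x)

/-- A map between manifolds is totally differentiable at `x` if it is continuous at `x` and some
local representative around `x` is totally differentiable at the image of `x`. -/
def MTotallyDifferentiableAt (E : Type*) [AddCommGroup E] [Module K E] [TopologicalSpace E]
    (F : Type*) [AddCommGroup F] [Module K F] [TopologicalSpace F]
    [ChartedSpace E M] [ChartedSpace F N] (f : M → N) (x : M) : Prop :=
  ContinuousAt f x ∧ ∃ (φ : OpenPartialHomeomorph M E) (ψ : OpenPartialHomeomorph N F),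
    IsChart K φ ∧ IsChart K ψ ∧ x ∈ φ.source ∧ f x ∈ ψ.source ∧
      TotallyDifferentiableAt K (repDomain φ ψ f) (ψ ∘ f ∘ φ.symm) (φ x)

end Manifolds

end TVSLie

/-! A homomorphism satisfies `f x' = f x * f (x⁻¹ * x')`, so its difference quotients near any point
come from those at `1`, transported by multiplication and inversion read in charts. Feeble
differentiability at `1` is a limit taken jointly in direction and scalar, so it may be applied to
the varying direction `t⁻¹ (φ (x⁻¹ (x + t y)) - φ 1)`. Hence the quotient at `(x', y', t)` converges
as `(x', y', t)` tends to `(x, y, 0)`, the base point being allowed to move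
(`exists_local_formula`). Extending the quotient by these limits yields `f^[1]`, so `f` is `C^1`
(`isCkOn_one_of_hasStrictDirDeriv`). Total differentiability reduces to the feeble kind by rescaling
the direction into the given `0`-neighbourhood.

The same formula writes `df : U × E → F` as a composite of `f`, smooth maps and a continuous linear
map. It therefore bootstraps: class `k` of `f` gives class `k` of `df`, hence class `k + 1` of `f`.
The class used here, `IsTCkOn`, iterates `df` instead of `f^[1]`; it is a priori weaker than
`IsCkOn` but has a simple chain rule.

Over `ℝ` or `ℂ` with locally convex target, both notions of smoothness agree. Hahn-Banach reduces
mean value estimates to scalar functions. These give symmetry of second derivatives and show that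
the Taylor remainder of order `n ≥ 1` divided by `t ^ n`, which for `n = 1` is `f^[1]`, is again
smooth in the sense of `IsTCkOn` (`isTSmoothOn_taylorQuot`). So the passage from `f` to `f^[1]` can
be repeated (`IsTSmoothOn.isCkOn`). -/

namespace TVSLie

/-! ### Strict directional derivatives and the chain rule. -/

section StrictCalculus

universe u u' v v' w

variable (K : Type w) [Field K] [TopologicalSpace K]
  {E : Type u} [AddCommGroup E] [Module K E] [TopologicalSpace E]
  {E' : Type u'} [AddCommGroup E'] [Module K E'] [TopologicalSpace E']
  {F : Type v} [AddCommGroup F] [Module K F] [TopologicalSpace F]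
  {F' : Type v'} [AddCommGroup F'] [Module K F'] [TopologicalSpace F']

/-- The difference quotient of `f`, as a function of `(x, y, t)`. -/
def diffQuot (f : E → F) (p : E × E × K) : F :=
  p.2.2⁻¹ • (f (p.1 + p.2.2 • p.2.1) - f p.1)

/-- `l` is the limit of the difference quotients of `f` at `(x', y', t)`, as `(x', y', t)` tends to
`(x, y, 0)` with `t ≠ 0`. -/
def HasStrictDirDeriv (f : E → F) (x y : E) (l : F) : Prop :=
  Tendsto (diffQuot K f) (𝓝[{p | p.2.2 ≠ 0}] (x, y, 0)) (𝓝 l)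

/-- The directional derivative, as a function of the point and the direction. -/
noncomputable def dirDeriv (f : E → F) (p : E × E) : F :=
  limUnder (𝓝[≠] (0 : K)) fun t => t⁻¹ • (f (p.1 + t • p.2) - f p.1)

/-- Iterated strict differentiability: `f` is continuous, has strict directional derivatives, and
the directional derivative is of the same kind, of lower order. -/
def IsTCkOn {F : Type v} [AddCommGroup F] [Module K F] [TopologicalSpace F] :
    ℕ → ∀ {E : Type u} [AddCommGroup E] [Module K E] [TopologicalSpace E],
      Set E → (E → F) → Prop
  | 0, _, _, _, _, U, f => ContinuousOn f U
  | n + 1, _, _, _, _, U, f => ContinuousOn f U ∧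
      (∀ x ∈ U, ∀ y, HasStrictDirDeriv K f x y (dirDeriv K f (x, y))) ∧
      IsTCkOn n (U ×ˢ univ) (dirDeriv K f)

variable {K}

theorem HasStrictDirDeriv.tendsto {f : E → F} {x y : E} {l : F} (h : HasStrictDirDeriv K f x y l)
    {α : Type*} {a : Filter α} {X Y : α → E} {T : α → K} (hX : Tendsto X a (𝓝 x))
    (hY : Tendsto Y a (𝓝 y)) (hT : Tendsto T a (𝓝 0)) (hT' : ∀ᶠ i in a, T i ≠ 0) :
    Tendsto (fun i => (T i)⁻¹ • (f (X i + T i • Y i) - f (X i))) a (𝓝 l) :=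
  Tendsto.comp h (tendsto_nhdsWithin_iff.2 ⟨hX.prodMk_nhds (hY.prodMk_nhds hT), hT'⟩)

theorem HasStrictDirDeriv.tendsto_slope {f : E → F} {x y : E} {l : F}
    (h : HasStrictDirDeriv K f x y l) :
    Tendsto (fun t : K => t⁻¹ • (f (x + t • y) - f x)) (𝓝[≠] 0) (𝓝 l) :=
  h.tendsto tendsto_const_nhds tendsto_const_nhds nhdsWithin_le_nhds self_mem_nhdsWithin

section Unique

variable [T2Space F] [(𝓝[≠] (0 : K)).NeBot]

theorem HasStrictDirDeriv.dirDeriv_eq {f : E → F} {x y : E} {l : F}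
    (h : HasStrictDirDeriv K f x y l) : dirDeriv K f (x, y) = l :=
  haveI : Nonempty F := ⟨0⟩
  h.tendsto_slope.limUnder_eq

theorem HasStrictDirDeriv.self {f : E → F} {x y : E} {l : F}
    (h : HasStrictDirDeriv K f x y l) : HasStrictDirDeriv K f x y (dirDeriv K f (x, y)) := by
  rwa [h.dirDeriv_eq]

end Unique

/-- Since `f (x' + t y')` equals `f x' + t • diffQuot K f (x', y', t)`, the quotient of `g ∘ f` at
`(x', y', t)` is that of `g` at `(f x', diffQuot K f (x', y', t), t)`. Strictness of `g` allows base
point and direction to vary, so linearity in the direction is not needed. -/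
theorem HasStrictDirDeriv.comp {f : E → F} {g : F → F'} {x y : E} {l : F} {m : F'}
    (hg : HasStrictDirDeriv K g (f x) l m) (hf : HasStrictDirDeriv K f x y l)
    (hc : ContinuousAt f x) : HasStrictDirDeriv K (g ∘ f) x y m := by
  have h1 : Tendsto (fun p : E × E × K => f p.1) (𝓝[{p | p.2.2 ≠ 0}] (x, y, 0)) (𝓝 (f x)) :=
    (Tendsto.comp hc (continuous_fst.tendsto (x, y, (0 : K)))).mono_left nhdsWithin_le_nhds
  have h2 : Tendsto (fun p : E × E × K => p.2.2) (𝓝[{p | p.2.2 ≠ 0}] (x, y, 0)) (𝓝 0) :=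
    ((continuous_snd.comp continuous_snd).tendsto (x, y, (0 : K))).mono_left nhdsWithin_le_nhds
  refine (hg.tendsto h1 hf h2 self_mem_nhdsWithin).congr' ?_
  filter_upwards [self_mem_nhdsWithin] with p hp
  have hp : p.2.2 ≠ 0 := hp
  simp only [diffQuot, Function.comp, smul_smul, mul_inv_cancel₀ hp, one_smul, add_sub_cancel]

theorem HasStrictDirDeriv.prodMk {f : E → F} {g : E → F'} {x y : E} {l : F} {m : F'}
    (hf : HasStrictDirDeriv K f x y l) (hg : HasStrictDirDeriv K g x y m) :
    HasStrictDirDeriv K (fun x => (f x, g x)) x y (l, m) :=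
  (Tendsto.prodMk_nhds hf hg).congr fun p => by simp [diffQuot]

theorem HasStrictDirDeriv.congr_of_eventuallyEq [ContinuousAdd E] [ContinuousSMul K E]
    {f g : E → F} {x y : E} {l : F}
    (hf : HasStrictDirDeriv K f x y l) (h : f =ᶠ[𝓝 x] g) : HasStrictDirDeriv K g x y l := by
  refine Tendsto.congr' ?_ hf
  have c1 : Tendsto (fun p : E × E × K => p.1) (𝓝 (x, y, (0 : K))) (𝓝 x) :=
    continuous_fst.tendsto (x, y, (0 : K))
  have c2 : Tendsto (fun p : E × E × K => p.1 + p.2.2 • p.2.1) (𝓝 (x, y, (0 : K))) (𝓝 x) := by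
    have : Continuous (fun p : E × E × K => p.1 + p.2.2 • p.2.1) := by fun_prop
    simpa using this.tendsto (x, y, (0 : K))
  filter_upwards [nhdsWithin_le_nhds (c1.eventually h), nhdsWithin_le_nhds (c2.eventually h)]
    with p h1 h2
  simp only [diffQuot, h1, h2]

theorem HasStrictDirDeriv.clm (A : E →L[K] F) (x y : E) : HasStrictDirDeriv K A x y (A y) := by
  have : Tendsto (fun p : E × E × K => A p.2.1) (𝓝[{p | p.2.2 ≠ 0}] (x, y, (0 : K))) (𝓝 (A y)) :=
    ((A.continuous.comp (continuous_fst.comp continuous_snd)).tendsto (x, y, (0 : K))).mono_left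
      nhdsWithin_le_nhds
  refine this.congr' ?_
  filter_upwards [self_mem_nhdsWithin] with p hp
  have hp : p.2.2 ≠ 0 := hp
  simp [diffQuot, smul_smul, inv_mul_cancel₀ hp]

theorem HasStrictDirDeriv.const (c : F) (x y : E) :
    HasStrictDirDeriv K (fun _ : E => c) x y 0 := by
  refine tendsto_const_nhds.congr fun p => ?_
  simp [diffQuot]

theorem dirDeriv_comp_clm (f : E → F) (A : E' →L[K] E) :
    dirDeriv K (f ∘ A) = dirDeriv K f ∘ (A.prodMap A) := by
  ext p
  simp [dirDeriv]

theorem IsTCkOn.continuousOn {k : ℕ} {U : Set E} {f : E → F} (h : IsTCkOn K k U f) :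
    ContinuousOn f U := by
  cases k with
  | zero => exact h
  | succ k => exact h.1

theorem IsTCkOn.strict {k : ℕ} {U : Set E} {f : E → F} (h : IsTCkOn K (k + 1) U f) {x : E}
    (hx : x ∈ U) (y : E) : HasStrictDirDeriv K f x y (dirDeriv K f (x, y)) :=
  h.2.1 x hx y

theorem IsTCkOn.dirDeriv {k : ℕ} {U : Set E} {f : E → F} (h : IsTCkOn K (k + 1) U f) :
    IsTCkOn K k (U ×ˢ univ) (dirDeriv K f) :=
  h.2.2

theorem IsTCkOn.of_succ {k : ℕ} : ∀ {E : Type u} [AddCommGroup E] [Module K E]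
    [TopologicalSpace E] {U : Set E} {f : E → F}, IsTCkOn K (k + 1) U f → IsTCkOn K k U f := by
  induction k with
  | zero => intro E _ _ _ U f h; exact h.1
  | succ k ih => intro E _ _ _ U f h; exact ⟨h.1, h.2.1, ih h.2.2⟩

theorem IsTCkOn.mono {k : ℕ} : ∀ {E : Type u} [AddCommGroup E] [Module K E]
    [TopologicalSpace E] {U V : Set E} {f : E → F}, IsTCkOn K k V f → U ⊆ V →
      IsTCkOn K k U f := by
  induction k with
  | zero => intro E _ _ _ U V f h hUV; exact ContinuousOn.mono h hUV
  | succ k ih =>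
    intro E _ _ _ U V f h hUV
    exact ⟨h.1.mono hUV, fun x hx => h.2.1 x (hUV hx), ih h.2.2 (prod_mono_left hUV)⟩

/-- `IsTCkOn` is a local property. -/
theorem IsTCkOn.of_local {k : ℕ} : ∀ {E : Type u} [AddCommGroup E] [Module K E]
    [TopologicalSpace E] {U : Set E} {f : E → F},
    (∀ x ∈ U, ∃ O, IsOpen O ∧ x ∈ O ∧ IsTCkOn K k (U ∩ O) f) → IsTCkOn K k U f := by
  have h0 : ∀ (k : ℕ) {E : Type u} [AddCommGroup E] [Module K E] [TopologicalSpace E]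
      {U : Set E} {f : E → F},
      (∀ x ∈ U, ∃ O, IsOpen O ∧ x ∈ O ∧ IsTCkOn K k (U ∩ O) f) → ContinuousOn f U := by
    intro k E _ _ _ U f h x hx
    obtain ⟨O, hO, hxO, h⟩ := h x hx
    exact (h.continuousOn x ⟨hx, hxO⟩).mono_of_mem_nhdsWithin
      (inter_mem self_mem_nhdsWithin (mem_nhdsWithin_of_mem_nhds (hO.mem_nhds hxO)))
  induction k with
  | zero => intro E _ _ _ U f h; exact h0 0 h
  | succ k ih =>
    intro E _ _ _ U f h
    refine ⟨h0 _ h, fun x hx => ?_, ih ?_⟩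
    · obtain ⟨O, hO, hxO, h⟩ := h x hx
      exact h.2.1 x ⟨hx, hxO⟩
    · rintro ⟨x, y⟩ ⟨hx, -⟩
      obtain ⟨O, hO, hxO, h⟩ := h x hx
      refine ⟨O ×ˢ univ, hO.prod isOpen_univ, ⟨hxO, mem_univ _⟩, ?_⟩
      rw [prod_inter_prod, univ_inter]
      exact h.2.2

section Calculus

variable [IsTopologicalAddGroup E] [ContinuousSMul K E]

theorem dirDeriv_eqOn_of_eqOn {U : Set E} (hU : IsOpen U) {f g : E → F} (h : EqOn f g U) :
    EqOn (dirDeriv K f) (dirDeriv K g) (U ×ˢ univ) := by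
  rintro ⟨x, y⟩ ⟨hx, -⟩
  have : Tendsto (fun t : K => x + t • y) (𝓝[≠] 0) (𝓝 x) := by
    have : Continuous (fun t : K => x + t • y) := by fun_prop
    simpa using (this.tendsto 0).mono_left nhdsWithin_le_nhds
  have : (fun t : K => t⁻¹ • (f (x + t • y) - f x)) =ᶠ[𝓝[≠] 0]
      fun t : K => t⁻¹ • (g (x + t • y) - g x) := by
    filter_upwards [this (hU.mem_nhds hx)] with t ht
    simp only [h ht, h hx]
  simp only [dirDeriv, limUnder, Filter.map_congr this]

end Calculus

theorem IsTCkOn.congr [IsTopologicalRing K] [(𝓝[≠] (0 : K)).NeBot] [T2Space F] {k : ℕ} :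
    ∀ {E : Type u} [AddCommGroup E] [Module K E]
    [TopologicalSpace E] [IsTopologicalAddGroup E] [ContinuousSMul K E] {U : Set E} {f g : E → F},
    IsTCkOn K k U f → IsOpen U → EqOn f g U → IsTCkOn K k U g := by
  induction k with
  | zero => intro E _ _ _ _ _ U f g h hU hfg; exact ContinuousOn.congr h hfg.symm
  | succ k ih =>
    intro E _ _ _ _ _ U f g h hU hfg
    have hd := dirDeriv_eqOn_of_eqOn (K := K) hU hfg
    refine ⟨h.1.congr hfg.symm, fun x hx y => ?_, ih h.2.2 (hU.prod isOpen_univ) hd⟩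
    rw [← hd ⟨hx, mem_univ _⟩]
    exact (h.2.1 x hx y).congr_of_eventuallyEq (hfg.eventuallyEq_of_mem (hU.mem_nhds hx))

/-- The recursion step with an explicitly given derivative. -/
theorem IsTCkOn.succ_of_hasStrictDirDeriv [IsTopologicalRing K] [(𝓝[≠] (0 : K)).NeBot] [T2Space F]
    [IsTopologicalAddGroup E] [ContinuousSMul K E] {k : ℕ} {U : Set E}
    {f : E → F} {f' : E × E → F} (hU : IsOpen U) (hc : ContinuousOn f U)
    (hf : ∀ x ∈ U, ∀ y, HasStrictDirDeriv K f x y (f' (x, y))) (hf' : IsTCkOn K k (U ×ˢ univ) f') :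
    IsTCkOn K (k + 1) U f :=
  ⟨hc, fun x hx y => (hf x hx y).self,
    hf'.congr (hU.prod isOpen_univ) fun p hp => (hf p.1 hp.1 p.2).dirDeriv_eq.symm⟩

section Operations

variable [(𝓝[≠] (0 : K)).NeBot] [T2Space F] [T2Space F']

/-- Proved ahead of the chain rule, whose induction step uses it to regard `f` as a function of `(x,
y)`. It needs no product or composition lemmas because `dirDeriv` commutes with linear
substitutions. -/
theorem IsTCkOn.comp_clm {k : ℕ} :
    ∀ {E : Type u} [AddCommGroup E] [Module K E] [TopologicalSpace E]
      [IsTopologicalAddGroup E] [ContinuousSMul K E]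
      {E' : Type u'} [AddCommGroup E'] [Module K E'] [TopologicalSpace E']
      [IsTopologicalAddGroup E'] [ContinuousSMul K E']
      {U : Set E} {f : E → F}, IsTCkOn K k U f → ∀ A : E' →L[K] E,
      IsTCkOn K k (A ⁻¹' U) (f ∘ A) := by
  induction k with
  | zero =>
    intro E _ _ _ _ _ E' _ _ _ _ _ U f h A
    exact ContinuousOn.comp h A.continuous.continuousOn fun _ h => h
  | succ k ih =>
    intro E _ _ _ _ _ E' _ _ _ _ _ U f h A
    refine ⟨h.1.comp A.continuous.continuousOn fun _ h => h, fun x hx y => ?_, ?_⟩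
    · exact ((h.2.1 (A x) hx (A y)).comp (HasStrictDirDeriv.clm A x y) A.continuous.continuousAt).self
    · rw [dirDeriv_comp_clm]
      exact (ih h.2.2 (A.prodMap A)).mono fun p hp => ⟨hp.1, mem_univ _⟩

variable [IsTopologicalRing K]

theorem IsTCkOn.clm {k : ℕ} :
    ∀ {E : Type u} [AddCommGroup E] [Module K E] [TopologicalSpace E]
      [IsTopologicalAddGroup E] [ContinuousSMul K E] (A : E →L[K] F), IsTCkOn K k univ A := by
  induction k with
  | zero => intro E _ _ _ _ _ A; exact A.continuous.continuousOn
  | succ k ih =>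
    intro E _ _ _ _ _ A
    refine IsTCkOn.succ_of_hasStrictDirDeriv isOpen_univ A.continuous.continuousOn
      (fun x _ y => HasStrictDirDeriv.clm A x y)
      ((ih (A.comp (ContinuousLinearMap.snd K E E))).mono (subset_univ _))

theorem IsTCkOn.const {k : ℕ} :
    ∀ {E : Type u} [AddCommGroup E] [Module K E] [TopologicalSpace E]
      [IsTopologicalAddGroup E] [ContinuousSMul K E] (c : F),
      IsTCkOn K k univ (fun _ : E => c) := by
  induction k with
  | zero => intro E _ _ _ _ _ A; exact continuousOn_const
  | succ k ih =>
    intro E _ _ _ _ _ c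
    refine IsTCkOn.succ_of_hasStrictDirDeriv isOpen_univ continuousOn_const
      (fun x _ y => HasStrictDirDeriv.const c x y) ((ih 0).mono (subset_univ _))

theorem IsTCkOn.prodMk {k : ℕ} :
    ∀ {E : Type u} [AddCommGroup E] [Module K E] [TopologicalSpace E]
      [IsTopologicalAddGroup E] [ContinuousSMul K E] {U : Set E} {f : E → F} {g : E → F'},
      IsTCkOn K k U f → IsTCkOn K k U g → IsOpen U → IsTCkOn K k U (fun x => (f x, g x)) := by
  induction k with
  | zero => intro E _ _ _ _ _ U f g hf hg hU; exact ContinuousOn.prodMk hf hg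
  | succ k ih =>
    intro E _ _ _ _ _ U f g hf hg hU
    exact IsTCkOn.succ_of_hasStrictDirDeriv (f' := fun p => (TVSLie.dirDeriv K f p, TVSLie.dirDeriv K g p))
      hU (hf.1.prodMk hg.1)
      (fun x hx y => (hf.2.1 x hx y).prodMk (hg.2.1 x hx y)) (ih hf.2.2 hg.2.2 (hU.prod isOpen_univ))

/-- The chain rule. -/
theorem IsTCkOn.comp {k : ℕ} :
    ∀ {E : Type u} [AddCommGroup E] [Module K E] [TopologicalSpace E]
      [IsTopologicalAddGroup E] [ContinuousSMul K E]
      {F : Type v} [AddCommGroup F] [Module K F] [TopologicalSpace F]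
      [IsTopologicalAddGroup F] [ContinuousSMul K F] [T2Space F]
      {U : Set E} {V : Set F} {f : E → F} {g : F → F'},
      IsTCkOn K k V g → IsTCkOn K k U f → IsOpen U → MapsTo f U V →
      IsTCkOn K k U (g ∘ f) := by
  induction k with
  | zero => intro E _ _ _ _ _ F _ _ _ _ _ _ U V f g hg hf hU h; exact ContinuousOn.comp hg hf h
  | succ k ih =>
    intro E _ _ _ _ _ F _ _ _ _ _ _ U V f g hg hf hU h
    -- The derivative of `g ∘ f` is `dg ∘ (f ∘ fst, df)`, a composite of maps of class `k`, so the
    -- induction hypothesis applies to it.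
    refine IsTCkOn.succ_of_hasStrictDirDeriv
      (f' := TVSLie.dirDeriv K g ∘ fun p => (f p.1, TVSLie.dirDeriv K f p)) hU (hg.1.comp hf.1 h)
      (fun x hx y => (hg.2.1 (f x) (h hx) _).comp (hf.2.1 x hx y)
        (hf.1.continuousAt (hU.mem_nhds hx))) ?_
    refine ih hg.2.2 (IsTCkOn.prodMk ?_ hf.2.2 (hU.prod isOpen_univ)) (hU.prod isOpen_univ)
      fun p hp => ⟨h hp.1, mem_univ _⟩
    exact (hf.of_succ.comp_clm (ContinuousLinearMap.fst K E E)).mono fun p hp => hp.1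

variable [IsTopologicalAddGroup F] [ContinuousSMul K F]

theorem IsTCkOn.add [IsTopologicalAddGroup E] [ContinuousSMul K E] {k : ℕ} {U : Set E}
    {f g : E → F} (hf : IsTCkOn K k U f) (hg : IsTCkOn K k U g) (hU : IsOpen U) :
    IsTCkOn K k U (fun x => f x + g x) :=
  (IsTCkOn.clm (ContinuousLinearMap.fst K F F + ContinuousLinearMap.snd K F F)).comp
    (hf.prodMk hg hU) hU (mapsTo_univ _ _)

theorem IsTCkOn.const_smul [IsTopologicalAddGroup E] [ContinuousSMul K E] {k : ℕ} {U : Set E}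
    {f : E → F} (hf : IsTCkOn K k U f) (c : K) (hU : IsOpen U) :
    IsTCkOn K k U (fun x => c • f x) :=
  (IsTCkOn.clm (c • ContinuousLinearMap.id K F)).comp hf hU (mapsTo_univ _ _)

/-- The derivative of scalar multiplication is a sum of two scalar multiplications precomposed with
linear maps, so the induction closes on itself. -/
theorem isTCkOn_smul {k : ℕ} : IsTCkOn K k univ (fun p : K × F => p.1 • p.2) := by
  induction k with
  | zero => exact continuous_smul.continuousOn
  | succ k ih =>
    refine IsTCkOn.succ_of_hasStrictDirDeriv (f' := fun p => p.2.1 • p.1.2 + p.1.1 • p.2.2)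
      isOpen_univ continuous_smul.continuousOn (fun x _ y => ?_) (IsTCkOn.add ?_ ?_ ?_)
    -- This is the exact difference quotient for `t ≠ 0`, with the cross term `t c' v'`; being
    -- continuous in all variables, it has the product rule as its limit at `t = 0`.
    · have : Continuous (fun p : (K × F) × (K × F) × K =>
          p.2.1.1 • p.1.2 + p.1.1 • p.2.1.2 + p.2.2 • p.2.1.1 • p.2.1.2) := by fun_prop
      have := (this.tendsto (x, y, 0)).mono_left
        (nhdsWithin_le_nhds (s := {p : (K × F) × (K × F) × K | p.2.2 ≠ 0}))
      simp only [zero_smul, add_zero] at this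
      refine this.congr' ?_
      filter_upwards [self_mem_nhdsWithin] with p hp
      have hp : p.2.2 ≠ 0 := hp
      simp only [diffQuot, Prod.fst_add, Prod.snd_add, Prod.smul_fst, Prod.smul_snd, smul_eq_mul]
      rw [eq_inv_smul_iff₀ hp]
      module
    · exact (ih.comp_clm (((ContinuousLinearMap.fst K K F).comp (ContinuousLinearMap.snd K _ _)).prod
        ((ContinuousLinearMap.snd K K F).comp (ContinuousLinearMap.fst K _ _)))).mono fun _ _ => trivial
    · exact (ih.comp_clm (((ContinuousLinearMap.fst K K F).comp (ContinuousLinearMap.fst K _ _)).prod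
        ((ContinuousLinearMap.snd K K F).comp (ContinuousLinearMap.snd K _ _)))).mono fun _ _ => trivial
    · exact isOpen_univ.prod isOpen_univ

theorem IsTCkOn.smul [T2Space K] [IsTopologicalAddGroup E] [ContinuousSMul K E] {k : ℕ} {U : Set E}
    {c : E → K} {f : E → F} (hc : IsTCkOn K k U c) (hf : IsTCkOn K k U f) (hU : IsOpen U) :
    IsTCkOn K k U (fun x => c x • f x) :=
  isTCkOn_smul.comp (hc.prodMk hf hU) hU (mapsTo_univ _ _)

end Operations

end StrictCalculus

/-! ### From `IsCkOn` to iterated strict differentiability. -/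

section Compare

universe u u' v v' w

variable {K : Type w} [Field K] [TopologicalSpace K]
  {F : Type v} [AddCommGroup F] [Module K F] [TopologicalSpace F]

theorem isOpen_domOne {E : Type u} [AddCommGroup E] [Module K E] [TopologicalSpace E]
    [ContinuousAdd E] [ContinuousSMul K E] {U : Set E} (hU : IsOpen U) : IsOpen (domOne K U) := by
  have h : Continuous (fun p : E × E × K => p.1 + p.2.2 • p.2.1) := by fun_prop
  exact (hU.preimage continuous_fst).inter (hU.preimage h)

theorem domOne_preimage {E : Type u} [AddCommGroup E] [Module K E] [TopologicalSpace E]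
    {E' : Type u'} [AddCommGroup E'] [Module K E'] [TopologicalSpace E']
    (A : E' →L[K] E) (U : Set E) :
    A.prodMap (A.prodMap (ContinuousLinearMap.id K K)) ⁻¹' domOne K U = domOne K (A ⁻¹' U) := by
  ext p
  simp [domOne]

theorem IsDiffQuotient.comp_clm {E : Type u} [AddCommGroup E] [Module K E] [TopologicalSpace E]
    {E' : Type u'} [AddCommGroup E'] [Module K E'] [TopologicalSpace E']
    {U : Set E} {f : E → F} {g : E × E × K → F} (h : IsDiffQuotient U f g) (A : E' →L[K] E) :
    IsDiffQuotient (A ⁻¹' U) (f ∘ A) (g ∘ A.prodMap (A.prodMap (ContinuousLinearMap.id K K))) := by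
  refine ⟨h.1.comp (ContinuousLinearMap.continuous _).continuousOn fun p hp => ?_,
    fun x y t hp ht => ?_⟩
  · rwa [← domOne_preimage] at hp
  · rw [← domOne_preimage] at hp
    simpa using h.2 _ _ _ hp ht

theorem IsCkOn.comp_clm {k : ℕ} {E : Type u} [AddCommGroup E] [Module K E] [TopologicalSpace E]
    {E' : Type u'} [AddCommGroup E'] [Module K E'] [TopologicalSpace E']
    {U : Set E} {f : E → F} (h : IsCkOn K k U f) (A : E' →L[K] E) :
    IsCkOn K k (A ⁻¹' U) (f ∘ A) := by
  -- The step `E ↦ E × E × K` stays inside the universe `max u w`, so the induction is carried out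
  -- there. A single unfolding then brings spaces in arbitrary universes into this range.
  have aux : ∀ (k : ℕ) (E : Type (max u w)) [AddCommGroup E] [Module K E] [TopologicalSpace E]
      (E' : Type (max u' w)) [AddCommGroup E'] [Module K E'] [TopologicalSpace E']
      (U : Set E) (f : E → F) (_ : IsCkOn K k U f) (A : E' →L[K] E),
      IsCkOn K k (A ⁻¹' U) (f ∘ A) := by
    intro k
    induction k with
    | zero => intro E _ _ _ E' _ _ _ U f h A; exact h.comp A.continuous.continuousOn fun _ h => h
    | succ k ih =>
      intro E _ _ _ E' _ _ _ U f h A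
      obtain ⟨hc, g, hg, hg'⟩ := (isCkOn_succ K k U f).1 h
      refine (isCkOn_succ K k _ _).2 ⟨hc.comp A.continuous.continuousOn fun _ h => h, _,
        hg.comp_clm A, ?_⟩
      rw [← domOne_preimage]
      exact ih _ _ _ _ hg' _
  cases k with
  | zero => exact ContinuousOn.comp h A.continuous.continuousOn fun _ h => h
  | succ k =>
    obtain ⟨hc, g, hg, hg'⟩ := (isCkOn_succ K k U f).1 h
    refine (isCkOn_succ K k _ _).2 ⟨hc.comp A.continuous.continuousOn fun _ h => h, _,
      hg.comp_clm A, ?_⟩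
    rw [← domOne_preimage]
    exact aux _ _ _ _ _ hg' _

theorem IsCkOn.mono {k : ℕ} {E : Type u} [AddCommGroup E] [Module K E] [TopologicalSpace E]
    {U V : Set E} {f : E → F} (h : IsCkOn K k V f) (hUV : U ⊆ V) : IsCkOn K k U f := by
  have sub {E : Type (max u w)} [AddCommGroup E] [Module K E] {U V : Set E} (hUV : U ⊆ V) :
      domOne K U ⊆ domOne K V := fun p hp => ⟨hUV hp.1, hUV hp.2⟩
  have sub' : domOne K U ⊆ domOne K V := fun p hp => ⟨hUV hp.1, hUV hp.2⟩
  have aux : ∀ (k : ℕ) (E : Type (max u w)) [AddCommGroup E] [Module K E] [TopologicalSpace E]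
      (U V : Set E) (f : E → F) (_ : IsCkOn K k V f) (_ : U ⊆ V), IsCkOn K k U f := by
    intro k
    induction k with
    | zero => intro E _ _ _ U V f h hUV; exact ContinuousOn.mono h hUV
    | succ k ih =>
      intro E _ _ _ U V f h hUV
      obtain ⟨hc, g, hg, hg'⟩ := (isCkOn_succ K k V f).1 h
      exact (isCkOn_succ K k _ _).2 ⟨hc.mono hUV, g, ⟨hg.1.mono (sub hUV),
        fun x y t hp => hg.2 x y t (sub hUV hp)⟩, ih _ _ _ _ hg' (sub hUV)⟩
  cases k with
  | zero => exact ContinuousOn.mono h hUV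
  | succ k =>
    obtain ⟨hc, g, hg, hg'⟩ := (isCkOn_succ K k V f).1 h
    exact (isCkOn_succ K k _ _).2 ⟨hc.mono hUV, g, ⟨hg.1.mono sub',
      fun x y t hp => hg.2 x y t (sub' hp)⟩, aux _ _ _ _ _ hg' sub'⟩

theorem IsDiffQuotient.hasStrictDirDeriv {E : Type u} [AddCommGroup E] [Module K E]
    [TopologicalSpace E] [IsTopologicalAddGroup E] [ContinuousSMul K E]
    {U : Set E} {f : E → F} {g : E × E × K → F} (h : IsDiffQuotient U f g) (hU : IsOpen U)
    {x : E} (hx : x ∈ U) (y : E) : HasStrictDirDeriv K f x y (g (x, y, 0)) := by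
  have hmem : domOne K U ∈ 𝓝 (x, y, (0 : K)) :=
    (isOpen_domOne hU).mem_nhds ⟨hx, by simpa using hx⟩
  refine (((h.1.continuousAt hmem).tendsto).mono_left nhdsWithin_le_nhds).congr' ?_
  filter_upwards [self_mem_nhdsWithin, nhdsWithin_le_nhds hmem] with p hp hp'
  exact h.2 _ _ _ hp' hp

variable [T2Space F] [(𝓝[≠] (0 : K)).NeBot] [IsTopologicalRing K]

/-- The derivative is the restriction of `f^[1]` to `t = 0`, that is, `f^[1]` composed with the
linear embedding `(x, y) ↦ (x, y, 0)`. Its class is therefore that of `f^[1]`. -/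
theorem IsCkOn.isTCkOn {k : ℕ} : ∀ {E : Type u} [AddCommGroup E] [Module K E]
    [TopologicalSpace E] [IsTopologicalAddGroup E] [ContinuousSMul K E] {U : Set E} {f : E → F},
    IsCkOn K k U f → IsOpen U → IsTCkOn K k U f := by
  induction k with
  | zero => intro E _ _ _ _ _ U f h hU; exact h
  | succ k ih =>
    intro E _ _ _ _ _ U f h hU
    obtain ⟨hc, g, hg, hg'⟩ := (isCkOn_succ K k U f).1 h
    refine IsTCkOn.succ_of_hasStrictDirDeriv (f' := fun p => g (p.1, p.2, 0)) hU hc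
      (fun x hx y => hg.hasStrictDirDeriv hU hx y) (ih ?_ (hU.prod isOpen_univ))
    refine (hg'.comp_clm ((ContinuousLinearMap.fst K E E).prod
      ((ContinuousLinearMap.snd K E E).prod 0))).mono fun p hp => ?_
    exact ⟨hp.1, by simpa using hp.1⟩

end Compare

/-! ### A criterion for `C^1`. -/

section CriterionOne

variable {K : Type*} [Field K] [TopologicalSpace K]
  {E : Type*} [AddCommGroup E] [Module K E] [TopologicalSpace E] [IsTopologicalAddGroup E]
  [ContinuousSMul K E]
  {F : Type*} [AddCommGroup F] [Module K F] [TopologicalSpace F] [IsTopologicalAddGroup F]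
  [ContinuousSMul K F]

theorem continuousOn_diffQuot [IsTopologicalDivisionRing K] {U : Set E} {f : E → F} (hc : ContinuousOn f U) :
    ContinuousOn (diffQuot K f) (domOne K U ∩ {p | p.2.2 ≠ 0}) := by
  have h : Continuous (fun p : E × E × K => p.1 + p.2.2 • p.2.1) := by fun_prop
  refine ContinuousOn.smul (ContinuousOn.inv₀ (by fun_prop) fun p hp => hp.2) (ContinuousOn.sub ?_ ?_)
  · exact hc.comp h.continuousOn fun p hp => hp.1.2
  · exact hc.comp continuous_fst.continuousOn fun p hp => hp.1.1

theorem domOne_subset_closure [(𝓝[≠] (0 : K)).NeBot] {U : Set E} (hU : IsOpen U) :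
    domOne K U ⊆ closure (domOne K U ∩ {p | p.2.2 ≠ 0}) := by
  rintro ⟨x, y, t⟩ hp
  by_cases ht : t = 0
  · subst ht
    have h : Tendsto (fun s : K => (x, y, s)) (𝓝[≠] 0) (𝓝 (x, y, 0)) := by
      have : Continuous (fun s : K => (x, y, s)) := by fun_prop
      exact (this.tendsto 0).mono_left nhdsWithin_le_nhds
    refine mem_closure_of_tendsto h ?_
    filter_upwards [h ((isOpen_domOne hU).mem_nhds hp), self_mem_nhdsWithin] with s hs hs'
    exact ⟨hs, hs'⟩
  · exact subset_closure ⟨hp, ht⟩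

/-- A continuous map with strict directional derivatives everywhere is `C^1`. -/
theorem isCkOn_one_of_hasStrictDirDeriv [IsTopologicalDivisionRing K] [(𝓝[≠] (0 : K)).NeBot]
    [T2Space F] {U : Set E} (hU : IsOpen U) {f : E → F}
    (hc : ContinuousOn f U) (hf : ∀ x ∈ U, ∀ y, ∃ l, HasStrictDirDeriv K f x y l) :
    IsCkOn K 1 U f := by
  have hcl := domOne_subset_closure (K := K) hU
  have hlim : ∀ p ∈ domOne K U, ∃ l,
      Tendsto (diffQuot K f) (𝓝[domOne K U ∩ {p | p.2.2 ≠ 0}] p) (𝓝 l) := by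
    rintro ⟨x, y, t⟩ hp
    by_cases ht : t = 0
    · subst ht
      obtain ⟨l, hl⟩ := hf x hp.1 y
      exact ⟨l, hl.mono_left (nhdsWithin_mono _ inter_subset_right)⟩
    · exact ⟨_, continuousOn_diffQuot hc _ ⟨hp, ht⟩⟩
  -- Extension by limits is continuous because the target is regular, as every topological group is.
  have hg := continuousOn_extendFrom hcl hlim
  refine (isCkOn_succ K 0 U f).2 ⟨hc, extendFrom (domOne K U ∩ {p | p.2.2 ≠ 0}) (diffQuot K f),
    ⟨hg, fun x y t hp ht => ?_⟩, hg⟩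
  exact extendFrom_eq (hcl hp) (continuousOn_diffQuot hc _ ⟨hp, ht⟩)

end CriterionOne

/-! ### Local representatives in charts. -/

section RepDomain

variable {M N E F : Type*} [TopologicalSpace M] [TopologicalSpace N] [TopologicalSpace E]
  [TopologicalSpace F] {φ : OpenPartialHomeomorph M E} {ψ : OpenPartialHomeomorph N F} {f : M → N}

theorem mem_repDomain {x : E} :
    x ∈ repDomain φ ψ f ↔ x ∈ φ.target ∧ f (φ.symm x) ∈ ψ.source := by
  constructor
  · rintro ⟨a, ⟨h1, h2⟩, rfl⟩
    exact ⟨φ.map_source h2, by rwa [φ.left_inv h2]⟩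
  · rintro ⟨h1, h2⟩
    exact ⟨φ.symm x, ⟨h2, φ.map_target h1⟩, φ.right_inv h1⟩

theorem apply_mem_repDomain {a : M} (ha : a ∈ φ.source) :
    φ a ∈ repDomain φ ψ f ↔ f a ∈ ψ.source := by
  rw [mem_repDomain, φ.left_inv ha, and_iff_right (φ.map_source ha)]

theorem isOpen_repDomain (hf : Continuous f) : IsOpen (repDomain φ ψ f) :=
  φ.isOpen_image_of_subset_source ((ψ.open_source.preimage hf).inter φ.open_source)
    inter_subset_right

theorem continuousOn_rep (hf : Continuous f) :
    ContinuousOn (ψ ∘ f ∘ φ.symm) (repDomain φ ψ f) :=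
  ψ.continuousOn.comp (hf.comp_continuousOn (φ.continuousOn_symm.mono fun _ hx =>
    (mem_repDomain.1 hx).1)) fun _ hx => (mem_repDomain.1 hx).2

end RepDomain

/-! ### Differentiating a homomorphism everywhere from its derivative at `1`. -/

section Homomorphisms

variable {K : Type*} [Field K] [TopologicalSpace K] [IsTopologicalDivisionRing K]
  [(𝓝[≠] (0 : K)).NeBot]
  {E : Type*} [AddCommGroup E] [Module K E] [TopologicalSpace E] [IsTopologicalAddGroup E]
  [ContinuousSMul K E] [T2Space E]
  {F : Type*} [AddCommGroup F] [Module K F] [TopologicalSpace F] [IsTopologicalAddGroup F]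
  [ContinuousSMul K F] [T2Space F]
  {G : Type*} [Group G] [TopologicalSpace G] [ChartedSpace E G] [LieGroupOver K E G]
  {H : Type*} [Group H] [TopologicalSpace H] [ChartedSpace F H] [LieGroupOver K F H]

/-- The strict directional derivatives of a local representative of a homomorphism `f`, expressed
through the derivative `L` of a local representative around `1`, and the multiplications and
inversion in charts. -/
theorem exists_local_formula {f : G →* H} (hf : Continuous f)
    {φ : OpenPartialHomeomorph G E} {ψ : OpenPartialHomeomorph H F} (hφ : IsChart K φ)
    (hψ : IsChart K ψ) (h1φ : 1 ∈ φ.source) (h1ψ : 1 ∈ ψ.source)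
    (hfd : FeeblyDifferentiableAt K (repDomain φ ψ f) (ψ ∘ f ∘ φ.symm) (φ 1)) :
    ∃ L : E →L[K] F, ∀ {φ' : OpenPartialHomeomorph G E} {ψ' : OpenPartialHomeomorph H F},
      IsChart K φ' → IsChart K ψ' → ∀ x₀ ∈ repDomain φ' ψ' f,
      ∃ (O : Set E) (i : E → E) (M : Set (E × E)) (m : E × E → E) (N : Set (F × F))
        (n : F × F → F) (q : F), IsOpen O ∧ x₀ ∈ O ∧ IsOpen M ∧ IsOpen N ∧
        (∀ k, IsTCkOn K k O i) ∧ (∀ k, IsTCkOn K k M m) ∧ (∀ k, IsTCkOn K k N n) ∧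
        ∀ x ∈ O, (i x, x) ∈ M ∧ ((ψ' ∘ f ∘ φ'.symm) x, q) ∈ N ∧
          ∀ y, HasStrictDirDeriv K (ψ' ∘ f ∘ φ'.symm) x y
            (dirDeriv K n (((ψ' ∘ f ∘ φ'.symm) x, q), (0, L (dirDeriv K m ((i x, x), (0, y)))))) := by
  obtain ⟨hU₀, -, -, L, g, hg, hg0, hgc⟩ := hfd
  refine ⟨L, fun {φ' ψ'} hφ' hψ' x₀ hx₀ => ?_⟩
  have hG : IsTopologicalGroup G := LieGroupOver.toIsTopologicalGroup K E
  have hH : IsTopologicalGroup H := LieGroupOver.toIsTopologicalGroup K F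
  have hx₀' := mem_repDomain.1 hx₀
  -- An auxiliary chart around the inverse of the base point, in which inversion is read near `x₀`.
  set e : OpenPartialHomeomorph G E := chartAt E (φ'.symm x₀)⁻¹ with he
  have heC : IsChart K e := LieGroupOver.compatible e (chart_mem_atlas E _)
  have hei : (φ'.symm x₀)⁻¹ ∈ e.source := mem_chart_source E _
  set O := repDomain φ' ψ' f ∩ repDomain φ' e (fun a : G => a⁻¹) with hO
  set M := repDomain (e.prod φ') φ (fun p : G × G => p.1 * p.2) with hM
  set N := repDomain (ψ'.prod ψ) ψ' (fun p : H × H => p.1 * p.2) with hN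
  set i : E → E := e ∘ (fun a : G => a⁻¹) ∘ φ'.symm with hi
  set m : E × E → E := φ ∘ (fun p : G × G => p.1 * p.2) ∘ (e.prod φ').symm with hm
  set n : F × F → F := ψ' ∘ (fun p : H × H => p.1 * p.2) ∘ (ψ'.prod ψ).symm with hn
  have hfO := isOpen_repDomain (φ := φ') (ψ := ψ') hf
  have hiO := isOpen_repDomain (φ := φ') (ψ := e) (continuous_inv (G := G))
  have oO : IsOpen O := hfO.inter hiO
  have oM : IsOpen M := isOpen_repDomain continuous_mul
  have oN : IsOpen N := isOpen_repDomain continuous_mul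
  have ci : ∀ k, IsTCkOn K k O i := fun k =>
    ((LieGroupOver.smooth_inv φ' e hφ' heC k).isTCkOn hiO).mono inter_subset_right
  have cm : ∀ k, IsTCkOn K k M m := fun k =>
    (LieGroupOver.smooth_mul e φ' φ heC hφ' hφ k).isTCkOn oM
  have cn : ∀ k, IsTCkOn K k N n := fun k =>
    (LieGroupOver.smooth_mul ψ' ψ ψ' hψ' hψ hψ' k).isTCkOn oN
  have hiM : ∀ x ∈ O, (i x, x) ∈ M := by
    intro x hx
    obtain ⟨h1, h2⟩ := mem_repDomain.1 hx.2
    refine mem_repDomain.2 ⟨⟨e.map_source h2, h1⟩, ?_⟩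
    simpa [hi, e.left_inv h2] using h1φ
  have hfN : ∀ x ∈ O, ((ψ' ∘ f ∘ φ'.symm) x, ψ 1) ∈ N := by
    intro x hx
    obtain ⟨h1, h2⟩ := mem_repDomain.1 hx.1
    refine mem_repDomain.2 ⟨⟨ψ'.map_source h2, ψ.map_source h1ψ⟩, ?_⟩
    simpa [ψ'.left_inv h2, ψ.left_inv h1ψ] using h2
  refine ⟨O, i, M, m, N, n, ψ 1, oO, ⟨hx₀, mem_repDomain.2 ⟨hx₀'.1, hei⟩⟩, oM, oN, ci, cm, cn,
    fun x hx => ⟨hiM x hx, hfN x hx, fun y => ?_⟩⟩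
  -- the values of the maps on the relevant points
  have em : ∀ x ∈ O, ∀ x' : E, m (i x, x') = φ ((φ'.symm x)⁻¹ * φ'.symm x') := by
    intro x hx x'
    obtain ⟨h1, h2⟩ := mem_repDomain.1 hx.2
    simp [hm, hi, e.left_inv h2]
  have en : ∀ x ∈ O, ∀ b ∈ ψ.source,
      n ((ψ' ∘ f ∘ φ'.symm) x, ψ b) = ψ' (f (φ'.symm x) * b) := by
    intro x hx b hb
    obtain ⟨h1, h2⟩ := mem_repDomain.1 hx.1
    simp [hn, ψ'.left_inv h2, ψ.left_inv hb]
  set l := 𝓝[{p : E × E × K | p.2.2 ≠ 0}] (x, y, 0) with hl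
  have t1 : Tendsto (fun p : E × E × K => p.1) l (𝓝 x) :=
    (continuous_fst.tendsto (x, y, (0 : K))).mono_left nhdsWithin_le_nhds
  have t2 : Tendsto (fun p : E × E × K => p.2.1) l (𝓝 y) :=
    ((continuous_fst.comp continuous_snd).tendsto (x, y, (0 : K))).mono_left nhdsWithin_le_nhds
  have t3 : Tendsto (fun p : E × E × K => p.2.2) l (𝓝 0) :=
    ((continuous_snd.comp continuous_snd).tendsto (x, y, (0 : K))).mono_left nhdsWithin_le_nhds
  have t3' : ∀ᶠ p in l, p.2.2 ≠ 0 := self_mem_nhdsWithin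
  have t4 : Tendsto (fun p : E × E × K => p.1 + p.2.2 • p.2.1) l (𝓝 x) := by
    simpa using t1.add (t3.smul t2)
  have ti : Tendsto (fun p : E × E × K => i p.1) l (𝓝 (i x)) :=
    (((ci 0).continuousOn.continuousAt (oO.mem_nhds hx)).tendsto).comp t1
  have tf : Tendsto (fun p : E × E × K => (ψ' ∘ f ∘ φ'.symm) p.1) l (𝓝 ((ψ' ∘ f ∘ φ'.symm) x)) :=
    (((continuousOn_rep hf).continuousAt (hfO.mem_nhds hx.1)).tendsto).comp t1
  -- `Z` is the direction in the chart at `1` for which `φ 1 + t Z` represents `x⁻¹ (x + t y)`. It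
  -- converges because `m` is strictly differentiable; the slot `i x` does not move along `(0, y)`.
  set Z : E × E × K → E := fun p =>
    p.2.2⁻¹ • (m ((i p.1, p.1) + p.2.2 • ((0 : E), p.2.1)) - m (i p.1, p.1)) with hZ
  have tZ : Tendsto Z l (𝓝 (dirDeriv K m ((i x, x), (0, y)))) :=
    ((cm 1).strict (hiM x hx) (0, y)).tendsto (ti.prodMk_nhds t1)
      (tendsto_const_nhds.prodMk_nhds t2) t3 t3'
  have eO : ∀ᶠ p in l, p.1 ∈ O := t1 (oO.mem_nhds hx)
  have eM : ∀ᶠ p in l, (i p.1, p.1 + p.2.2 • p.2.1) ∈ M :=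
    (ti.prodMk_nhds t4) (oM.mem_nhds (hiM x hx))
  have eZ : ∀ᶠ p in l, φ 1 + p.2.2 • Z p = m (i p.1, p.1 + p.2.2 • p.2.1) := by
    filter_upwards [eO, t3'] with p hp hp0
    have h := em p.1 hp p.1
    rw [inv_mul_cancel] at h
    simp only [hZ, smul_smul, mul_inv_cancel₀ hp0, one_smul, h, add_sub_cancel, Prod.smul_mk,
      smul_zero, Prod.mk_add_mk, add_zero]
  have eU : ∀ᶠ p in l, φ 1 + p.2.2 • Z p ∈ repDomain φ ψ f := by
    have : Tendsto (fun p => φ 1 + p.2.2 • Z p) l (𝓝 (φ 1)) := by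
      simpa using tendsto_const_nhds.add (t3.smul tZ)
    refine this (hU₀.mem_nhds ?_)
    rw [apply_mem_repDomain h1φ, map_one]
    exact h1ψ
  -- The hypothesis at `1` enters here: `g` is jointly continuous at `(lim Z, 0)`, with value `L
  -- (lim Z)`.
  have tW : Tendsto (fun p => g (Z p, p.2.2)) l (𝓝 (L (dirDeriv K m ((i x, x), (0, y))))) := by
    rw [← hg0]
    refine (hgc _ (Or.inr rfl)).tendsto.comp (tendsto_nhdsWithin_iff.2 ⟨tZ.prodMk_nhds t3, ?_⟩)
    filter_upwards [eU, t3'] with p hp hp0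
    exact Or.inl ⟨hp0, hp⟩
  -- By `f (x + t y) = f x * f (x⁻¹ (x + t y))`, the quotient of `f` is the quotient of `n` at `(f
  -- x, ψ 1)` in the direction `(0, g (Z, t))`.
  refine (((cn 1).strict (hfN x hx) _).tendsto (tf.prodMk_nhds tendsto_const_nhds)
    (tendsto_const_nhds.prodMk_nhds tW) t3 t3').congr' ?_
  filter_upwards [eO, eM, eZ, eU, t3'] with p hO hM hZ hU hp0
  have hU' := hU
  rw [hZ, em _ hO, apply_mem_repDomain] at hU'
  swap
  · have := (mem_repDomain.1 hM).2
    obtain ⟨h1, h2⟩ := mem_repDomain.1 hO.2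
    simpa [hi, e.left_inv h2] using this
  have hsrc : (φ'.symm p.1)⁻¹ * φ'.symm (p.1 + p.2.2 • p.2.1) ∈ φ.source := by
    have := (mem_repDomain.1 hM).2
    obtain ⟨h1, h2⟩ := mem_repDomain.1 hO.2
    simpa [hi, e.left_inv h2] using this
  have e0 : n ((ψ' ∘ f ∘ φ'.symm) p.1, ψ 1) = (ψ' ∘ f ∘ φ'.symm) p.1 := by
    rw [en _ hO _ h1ψ, mul_one]; rfl
  have e1 : ψ 1 + p.2.2 • g (Z p, p.2.2) =
      ψ (f ((φ'.symm p.1)⁻¹ * φ'.symm (p.1 + p.2.2 • p.2.1))) := by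
    rw [hg _ _ hp0 hU, smul_smul, mul_inv_cancel₀ hp0, one_smul, hZ, em _ hO]
    simp only [Function.comp, φ.left_inv h1φ, φ.left_inv hsrc, map_one, add_sub_cancel]
  have e2 : n ((ψ' ∘ f ∘ φ'.symm) p.1, ψ 1 + p.2.2 • g (Z p, p.2.2)) =
      (ψ' ∘ f ∘ φ'.symm) (p.1 + p.2.2 • p.2.1) := by
    rw [e1, en _ hO _ hU', ← map_mul, mul_inv_cancel_left]; rfl
  simp only [Prod.smul_mk, smul_zero, Prod.mk_add_mk, add_zero]
  rw [e0, e2]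
  rfl

theorem MFeeblyDifferentiableAt.exists_local_formula {f : G →* H}
    (h : MFeeblyDifferentiableAt K E F f 1) :
    Continuous f ∧ ∃ L : E →L[K] F,
      ∀ {φ' : OpenPartialHomeomorph G E} {ψ' : OpenPartialHomeomorph H F},
      IsChart K φ' → IsChart K ψ' → ∀ x₀ ∈ repDomain φ' ψ' f,
      ∃ (O : Set E) (i : E → E) (M : Set (E × E)) (m : E × E → E) (N : Set (F × F))
        (n : F × F → F) (q : F), IsOpen O ∧ x₀ ∈ O ∧ IsOpen M ∧ IsOpen N ∧
        (∀ k, IsTCkOn K k O i) ∧ (∀ k, IsTCkOn K k M m) ∧ (∀ k, IsTCkOn K k N n) ∧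
        ∀ x ∈ O, (i x, x) ∈ M ∧ ((ψ' ∘ f ∘ φ'.symm) x, q) ∈ N ∧
          ∀ y, HasStrictDirDeriv K (ψ' ∘ f ∘ φ'.symm) x y
            (TVSLie.dirDeriv K n
              (((ψ' ∘ f ∘ φ'.symm) x, q), (0, L (dirDeriv K m ((i x, x), (0, y)))))) := by
  have hG : IsTopologicalGroup G := LieGroupOver.toIsTopologicalGroup K E
  have hH : IsTopologicalGroup H := LieGroupOver.toIsTopologicalGroup K F
  obtain ⟨hc, φ, ψ, hφ, hψ, h1, h2, hfd⟩ := h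
  have hf : Continuous f := continuous_of_continuousAt_one f hc
  exact ⟨hf, TVSLie.exists_local_formula hf hφ hψ h1 (by rwa [map_one] at h2) hfd⟩

theorem MFeeblyDifferentiableAt.isCkMap_one {f : G →* H}
    (h : MFeeblyDifferentiableAt K E F f 1) : IsCkMap K E F 1 f := by
  obtain ⟨hf, L, hL⟩ := h.exists_local_formula
  refine ⟨hf, fun φ ψ hφ hψ => isCkOn_one_of_hasStrictDirDeriv (isOpen_repDomain hf)
    (continuousOn_rep hf) fun x hx y => ?_⟩
  obtain ⟨O, i, M, m, N, n, q, -, hxO, -, -, -, -, -, hO⟩ := hL hφ hψ x hx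
  exact ⟨_, (hO x hxO).2.2 y⟩

/-- Bootstrapping: local representatives of a homomorphism that is feebly differentiable at `1`
are iteratedly strictly differentiable. -/
theorem MFeeblyDifferentiableAt.isTCkOn {f : G →* H}
    (h : MFeeblyDifferentiableAt K E F f 1) {φ : OpenPartialHomeomorph G E}
    {ψ : OpenPartialHomeomorph H F} (hφ : IsChart K φ) (hψ : IsChart K ψ) (k : ℕ) :
    IsTCkOn K k (repDomain φ ψ f) (ψ ∘ f ∘ φ.symm) := by
  obtain ⟨hf, L, hL⟩ := h.exists_local_formula
  induction k with
  | zero => exact continuousOn_rep hf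
  | succ k ih =>
    refine IsTCkOn.of_local fun x hx => ?_
    obtain ⟨O, i, M, m, N, n, q, oO, hxO, oM, oN, ci, cm, cn, hO⟩ := hL hφ hψ x hx
    have oU : IsOpen (repDomain φ ψ f ∩ O) := (isOpen_repDomain hf).inter oO
    have oU' := oU.prod (isOpen_univ (X := E))
    have ih' := ih.mono (inter_subset_left (t := O))
    -- The derivative involves `f` itself but no derivative of `f`: all else is `L` or a smooth map
    -- from the group structures. Class `k` of `f` thus gives class `k` of `df`.
    refine ⟨O, oO, hxO, IsTCkOn.succ_of_hasStrictDirDeriv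
      (f' := fun p => TVSLie.dirDeriv K n (((ψ ∘ f ∘ φ.symm) p.1, q),
        (0, L (TVSLie.dirDeriv K m ((i p.1, p.1), (0, p.2)))))) oU ih'.continuousOn
      (fun x hx y => (hO x hx.2).2.2 y) ?_⟩
    have c1 : IsTCkOn K k ((repDomain φ ψ f ∩ O) ×ˢ univ) (fun p : E × E => p.1) :=
      (IsTCkOn.clm (ContinuousLinearMap.fst K E E)).mono (subset_univ _)
    have c2 : IsTCkOn K k ((repDomain φ ψ f ∩ O) ×ˢ univ) (fun p : E × E => p.2) :=
      (IsTCkOn.clm (ContinuousLinearMap.snd K E E)).mono (subset_univ _)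
    have c0 : IsTCkOn K k ((repDomain φ ψ f ∩ O) ×ˢ univ) (fun _ : E × E => (0 : E)) :=
      (IsTCkOn.const 0).mono (subset_univ _)
    have c0' : IsTCkOn K k ((repDomain φ ψ f ∩ O) ×ˢ univ) (fun _ : E × E => (0 : F)) :=
      (IsTCkOn.const 0).mono (subset_univ _)
    have cq : IsTCkOn K k ((repDomain φ ψ f ∩ O) ×ˢ univ) (fun _ : E × E => q) :=
      (IsTCkOn.const q).mono (subset_univ _)
    have ci' : IsTCkOn K k ((repDomain φ ψ f ∩ O) ×ˢ univ) (fun p : E × E => i p.1) :=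
      (ci k).comp c1 oU' fun p hp => hp.1.2
    have cf : IsTCkOn K k ((repDomain φ ψ f ∩ O) ×ˢ univ)
        (fun p : E × E => (ψ ∘ f ∘ φ.symm) p.1) :=
      ih'.comp c1 oU' fun p hp => hp.1
    have cm' := (cm (k + 1)).dirDeriv.comp ((ci'.prodMk c1 oU').prodMk (c0.prodMk c2 oU') oU') oU'
      fun p hp => ⟨(hO p.1 hp.1.2).1, mem_univ _⟩
    have cL := (IsTCkOn.clm L).comp cm' oU' (mapsTo_univ _ _)
    exact (cn (k + 1)).dirDeriv.comp ((cf.prodMk cq oU').prodMk (c0'.prodMk cL oU') oU') oU'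
      fun p hp => ⟨(hO p.1 hp.1.2).2.1, mem_univ _⟩

end Homomorphisms

/-! ### Total differentiability implies feeble differentiability. -/

section Total

variable {K : Type*} [NontriviallyNormedField K]
  {E : Type*} [AddCommGroup E] [Module K E] [TopologicalSpace E] [IsTopologicalAddGroup E]
  [ContinuousSMul K E]
  {F : Type*} [AddCommGroup F] [Module K F] [TopologicalSpace F] [IsTopologicalAddGroup F]
  [ContinuousSMul K F]

theorem TotallyDifferentiableAt.feeblyDifferentiableAt {U : Set E} {f : E → F} {x : E}
    (h : TotallyDifferentiableAt K U f x) (hU : IsOpen U) (hc : ContinuousOn f U) :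
    FeeblyDifferentiableAt K U f x := by
  classical
  obtain ⟨hUx, L, hL⟩ := h
  have hx : x ∈ U := mem_of_mem_nhds hUx
  set g : E × K → F := fun p =>
    if p.2 = 0 then L p.1 else p.2⁻¹ • (f (x + p.2 • p.1) - f x) with hg
  refine ⟨hU, hx, hc, L, g, fun y t ht _ => by simp [hg, ht], fun y => by simp [hg], ?_⟩
  have hline : Continuous (fun p : E × K => x + p.2 • p.1) := by fun_prop
  rintro ⟨y, t⟩ hyt
  by_cases ht : t = 0
  · subst ht
    refine ContinuousAt.continuousWithinAt ?_
    -- the remainder tends to zero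
    have hrem : Tendsto (fun p : E × K => g p - L p.1) (𝓝 (y, 0)) (𝓝 0) := by
      refine (nhds_basis_balanced K F).tendsto_right_iff.2 fun W hW => ?_
      obtain ⟨V, hV, I, hI, θ, hIV, hθ0, hθ, hh⟩ := hL W hW.1
      -- Rescale `y` into `V`: writing `t y' = (t s)(s⁻¹ y')` puts the remainder at `t y'` into `θ
      -- (t s) W`. Dividing by `t` leaves the factor `s (θ (t s) / (t s))`, which tends to `0` and
      -- is absorbed because `W` is balanced.
      obtain ⟨s, hs, hs0⟩ : ∃ s : K, s⁻¹ • y ∈ interior V ∧ s ≠ 0 := by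
        have : Tendsto (fun r : K => r • y) (𝓝[≠] 0) (𝓝 0) := by
          have h : Continuous (fun r : K => r • y) := by fun_prop
          simpa using (h.tendsto 0).mono_left nhdsWithin_le_nhds
        obtain ⟨r, hr, hr0⟩ := ((this.eventually_mem (interior_mem_nhds.2 hV)).and self_mem_nhdsWithin).exists
        have hr0 : r ≠ 0 := hr0
        exact ⟨r⁻¹, by simpa using hr, inv_ne_zero hr0⟩
      have e1 : ∀ᶠ p : E × K in 𝓝 (y, 0), s⁻¹ • p.1 ∈ interior V := by
        have h : Continuous (fun p : E × K => s⁻¹ • p.1) := by fun_prop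
        exact (h.tendsto (y, 0)) (isOpen_interior.mem_nhds hs)
      have ts : Tendsto (fun p : E × K => p.2 * s) (𝓝 (y, 0)) (𝓝 0) := by
        have h : Continuous (fun p : E × K => p.2 * s) := by fun_prop
        simpa using h.tendsto (y, 0)
      have hθ' : ∀ᶠ r : K in 𝓝 0, r ≠ 0 → ‖s * (θ r / r)‖ ≤ 1 := by
        have h : Tendsto (fun r => ‖s * (θ r / r)‖) (𝓝[≠] 0) (𝓝 0) := by
          simpa using (hθ.const_mul s).norm
        exact eventually_nhdsWithin_iff.1 ((h.eventually_lt_const one_pos).mono fun r hr => hr.le)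
      filter_upwards [e1, ts hI, ts.eventually hθ'] with p h1 h2 h3
      by_cases hp : p.2 = 0
      · simpa [hg, hp] using mem_of_mem_nhds hW.1
      · obtain ⟨w, hw, hwe⟩ := hh _ h2 _ (interior_subset h1)
        rw [smul_smul, mul_assoc, mul_inv_cancel₀ hs0, mul_one] at hwe
        have : g p - L p.1 = (s * (θ (p.2 * s) / (p.2 * s))) • w := by
          have e : s * (θ (p.2 * s) / (p.2 * s)) = p.2⁻¹ * θ (p.2 * s) := by field_simp
          rw [e, mul_smul, ← hwe, smul_sub, map_smul, smul_smul, inv_mul_cancel₀ hp, one_smul]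
          simp [hg, hp]
        rw [id, this]
        exact hW.2.smul_mem (h3 (mul_ne_zero hp hs0)) hw
    have hLy : Tendsto (fun p : E × K => L p.1) (𝓝 (y, 0)) (𝓝 (L y)) :=
      (L.continuous.comp continuous_fst).tendsto (y, (0 : K))
    have : Tendsto g (𝓝 (y, 0)) (𝓝 (L y)) := by simpa using hrem.add hLy
    simpa [ContinuousAt, hg] using this
  · refine ContinuousAt.continuousWithinAt ?_
    have hmem : x + t • y ∈ U := by
      rcases hyt with h | h
      · exact h.2
      · exact absurd h ht
    have hca : ContinuousAt (fun p : E × K => p.2⁻¹ • (f (x + p.2 • p.1) - f x)) (y, t) := by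
      refine ContinuousAt.smul (continuous_snd.continuousAt.inv₀ ht) (ContinuousAt.sub ?_ continuousAt_const)
      exact ContinuousAt.comp (f := fun p : E × K => x + p.2 • p.1)
        (hc.continuousAt (hU.mem_nhds hmem)) hline.continuousAt
    refine hca.congr ?_
    filter_upwards [continuous_snd.continuousAt.eventually_ne ht] with p hp
    simp [hg, hp]

theorem MTotallyDifferentiableAt.mFeeblyDifferentiableAt
    {G : Type*} [Group G] [TopologicalSpace G] [ChartedSpace E G] [LieGroupOver K E G]
    {H : Type*} [Group H] [TopologicalSpace H] [ChartedSpace F H] [LieGroupOver K F H]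
    {f : G →* H} (h : MTotallyDifferentiableAt K E F f 1) : MFeeblyDifferentiableAt K E F f 1 := by
  have hG : IsTopologicalGroup G := LieGroupOver.toIsTopologicalGroup K E
  have hH : IsTopologicalGroup H := LieGroupOver.toIsTopologicalGroup K F
  obtain ⟨hc, φ, ψ, hφ, hψ, h1, h2, hfd⟩ := h
  have hf : Continuous f := continuous_of_continuousAt_one f hc
  exact ⟨hc, φ, ψ, hφ, hψ, h1, h2,
    hfd.feeblyDifferentiableAt (isOpen_repDomain hf) (continuousOn_rep hf)⟩

end Total

/-! ### Dependence on the direction, and iterated directional derivatives. -/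

section Directions

universe u u' v w

variable {K : Type w} [Field K] [TopologicalSpace K]
  {E : Type u} [AddCommGroup E] [Module K E]
  {F : Type v} [AddCommGroup F] [Module K F] [TopologicalSpace F]

theorem dirDeriv_zero_right [T2Space F] [(𝓝[≠] (0 : K)).NeBot] (f : E → F) (x : E) :
    dirDeriv K f (x, 0) = 0 := by
  have : Tendsto (fun _ : K => (0 : F)) (𝓝[≠] (0 : K)) (𝓝 0) := tendsto_const_nhds
  simpa [dirDeriv] using this.limUnder_eq

variable [TopologicalSpace E]

/-- Go from `x'` to `x' + t y` and then on to the endpoint. The second quotient has the moving base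
point `x' + t y`, which strictness permits. -/
theorem HasStrictDirDeriv.add_direction [IsTopologicalAddGroup E] [ContinuousSMul K E]
    [ContinuousAdd F] {f : E → F} {x y y' : E} {l l' : F} (h : HasStrictDirDeriv K f x y l)
    (h' : HasStrictDirDeriv K f x y' l') : HasStrictDirDeriv K f x (y + y') (l + l') := by
  set a := 𝓝[{p : E × E × K | p.2.2 ≠ 0}] (x, y + y', 0)
  have t1 : Tendsto (fun p : E × E × K => p.1) a (𝓝 x) :=
    (continuous_fst.tendsto (x, y + y', (0 : K))).mono_left nhdsWithin_le_nhds
  have t2 : Tendsto (fun p : E × E × K => p.2.1) a (𝓝 (y + y')) :=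
    ((continuous_fst.comp continuous_snd).tendsto (x, y + y', (0 : K))).mono_left nhdsWithin_le_nhds
  have t3 : Tendsto (fun p : E × E × K => p.2.2) a (𝓝 0) :=
    ((continuous_snd.comp continuous_snd).tendsto (x, y + y', (0 : K))).mono_left nhdsWithin_le_nhds
  have t3' : ∀ᶠ p in a, p.2.2 ≠ 0 := self_mem_nhdsWithin
  have t4 : Tendsto (fun p : E × E × K => p.1 + p.2.2 • y) a (𝓝 x) := by
    simpa using t1.add (t3.smul (tendsto_const_nhds (x := y)))
  have t5 : Tendsto (fun p : E × E × K => p.2.1 - y) a (𝓝 y') := by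
    simpa using t2.sub (tendsto_const_nhds (x := y))
  refine ((h.tendsto t1 tendsto_const_nhds t3 t3').add (h'.tendsto t4 t5 t3 t3')).congr fun p => ?_
  rw [diffQuot, ← smul_add, smul_sub, add_assoc p.1, add_sub_cancel]
  congr 1
  abel

/-- For `c ≠ 0`, substitute `t * c` for `t` in the limit. -/
theorem dirDeriv_smul_right [T2Space F] [(𝓝[≠] (0 : K)).NeBot] [IsTopologicalRing K]
    [ContinuousConstSMul K F] {f : E → F} {x y : E} (c : K)
    (h : HasStrictDirDeriv K f x y (dirDeriv K f (x, y))) :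
    dirDeriv K f (x, c • y) = c • dirDeriv K f (x, y) := by
  by_cases hc : c = 0
  · simp [hc, dirDeriv_zero_right]
  · have ht : Tendsto (fun t : K => t * c) (𝓝[≠] 0) (𝓝 0) := by
      have : Continuous fun t : K => t * c := by fun_prop
      simpa using (this.tendsto 0).mono_left nhdsWithin_le_nhds
    have ht' : ∀ᶠ t : K in 𝓝[≠] 0, t * c ≠ 0 := by
      filter_upwards [self_mem_nhdsWithin] with t ht
      exact mul_ne_zero ht hc
    have := (h.tendsto tendsto_const_nhds tendsto_const_nhds ht ht').const_smul c
    have hF : Nonempty F := ⟨0⟩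
    refine Tendsto.limUnder_eq (Tendsto.congr (fun t => ?_) this)
    simp only [smul_smul]
    congr 1
    field_simp

variable (K) in
/-- The `n`-th directional derivative of `f` at the point `p.1` in the direction `p.2`. -/
noncomputable def iterDir {F : Type v} [AddCommGroup F] [Module K F] [TopologicalSpace F] :
    ℕ → ∀ {E : Type u} [AddCommGroup E] [Module K E] [TopologicalSpace E],
      (E → F) → E × E → F
  | 0, _, _, _, _, f, p => f p.1
  | n + 1, _, _, _, _, f, p => iterDir n (dirDeriv K f) (p, (p.2, 0))

theorem iterDir_comp_clm (n : ℕ) : ∀ {E : Type u} [AddCommGroup E] [Module K E]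
    [TopologicalSpace E] {E' : Type u'} [AddCommGroup E'] [Module K E'] [TopologicalSpace E']
    (f : E → F) (A : E' →L[K] E) (p : E' × E'),
    iterDir K n (f ∘ A) p = iterDir K n f (A p.1, A p.2) := by
  induction n with
  | zero => intro E _ _ _ E' _ _ _ f A p; rfl
  | succ n ih =>
    intro E _ _ _ E' _ _ _ f A p
    rw [iterDir, dirDeriv_comp_clm, ih, iterDir]
    simp [Prod.map]

theorem iterDir_eqOn_of_eqOn (n : ℕ) : ∀ {E : Type u} [AddCommGroup E] [Module K E]
    [TopologicalSpace E] [IsTopologicalAddGroup E] [ContinuousSMul K E] [IsTopologicalRing K]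
    {U : Set E} {f g : E → F},
    IsOpen U → EqOn f g U → EqOn (iterDir K n f) (iterDir K n g) (U ×ˢ univ) := by
  induction n with
  | zero => intro E _ _ _ _ _ _ U f g hU h p hp; exact h hp.1
  | succ n ih =>
    intro E _ _ _ _ _ _ U f g hU h p hp
    exact ih (hU.prod isOpen_univ) (dirDeriv_eqOn_of_eqOn hU h) ⟨hp, mem_univ _⟩

variable (K) in
/-- Smooth maps, with respect to the iterated strict differentiability. -/
def IsTSmoothOn (U : Set E) (f : E → F) : Prop := ∀ k, IsTCkOn K k U f

theorem IsTSmoothOn.dirDeriv {U : Set E} {f : E → F} (h : IsTSmoothOn K U f) :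
    IsTSmoothOn K (U ×ˢ univ) (dirDeriv K f) := fun k => (h (k + 1)).dirDeriv

theorem IsTSmoothOn.strict {U : Set E} {f : E → F} (h : IsTSmoothOn K U f) {x : E} (hx : x ∈ U)
    (y : E) : HasStrictDirDeriv K f x y (TVSLie.dirDeriv K f (x, y)) := (h 1).strict hx y

theorem IsTSmoothOn.continuousOn {U : Set E} {f : E → F} (h : IsTSmoothOn K U f) :
    ContinuousOn f U := (h 0).continuousOn

theorem IsTSmoothOn.iterDir [IsTopologicalRing K] [(𝓝[≠] (0 : K)).NeBot] [T2Space F] (n : ℕ) :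
    ∀ {E : Type u} [AddCommGroup E] [Module K E] [TopologicalSpace E] [IsTopologicalAddGroup E]
    [ContinuousSMul K E] {U : Set E} {f : E → F}, IsTSmoothOn K U f →
      IsTSmoothOn K (U ×ˢ univ) (iterDir K n f) := by
  induction n with
  | zero =>
    intro E _ _ _ _ _ U f h k
    exact ((h k).comp_clm (ContinuousLinearMap.fst K E E)).mono fun p hp => hp.1
  | succ n ih =>
    intro E _ _ _ _ _ U f h k
    -- The linear map is `(x, y) ↦ ((x, y), (y, 0))`; the entry `0` keeps the direction `y` of `df`
    -- fixed while the point moves along the line.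
    exact ((ih h.dirDeriv k).comp_clm ((ContinuousLinearMap.id K (E × E)).prod
      ((ContinuousLinearMap.snd K E E).prod 0))).mono fun p hp => ⟨hp, mem_univ _⟩

end Directions

/-! ### Mean value estimates and symmetry of second derivatives in locally convex spaces. -/

section LocallyConvex

universe u v w

variable {K : Type w} [RCLike K] {F : Type v} [AddCommGroup F] [Module K F] [TopologicalSpace F]

/-- The derivative of a curve, tested with continuous linear functionals. -/
def HasWeakDerivAt (γ : K → F) (γ' : F) (t : K) : Prop :=
  ∀ l : F →L[K] K, HasDerivAt (fun s => l (γ s)) (l γ') t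

theorem HasWeakDerivAt.sub {γ δ : K → F} {γ' δ' : F} {t : K} (h : HasWeakDerivAt γ γ' t)
    (h' : HasWeakDerivAt δ δ' t) : HasWeakDerivAt (fun s => γ s - δ s) (γ' - δ') t := fun l => by
  simpa only [map_sub] using (h l).fun_sub (h' l)

theorem HasWeakDerivAt.add {γ δ : K → F} {γ' δ' : F} {t : K} (h : HasWeakDerivAt γ γ' t)
    (h' : HasWeakDerivAt δ δ' t) : HasWeakDerivAt (fun s => γ s + δ s) (γ' + δ') t := fun l => by
  simpa only [map_add] using (h l).fun_add (h' l)

theorem HasWeakDerivAt.congr_deriv {γ : K → F} {γ' δ' : F} {t : K} (h : HasWeakDerivAt γ γ' t)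
    (e : γ' = δ') : HasWeakDerivAt γ δ' t := e ▸ h

theorem HasWeakDerivAt.smul {c : K → K} {c' : K} {γ : K → F} {γ' : F} {t : K}
    (hc : HasDerivAt c c' t) (h : HasWeakDerivAt γ γ' t) :
    HasWeakDerivAt (fun s => c s • γ s) (c' • γ t + c t • γ') t := fun l => by
  simpa only [map_smul, smul_eq_mul, map_add] using hc.fun_mul (h l)

theorem hasWeakDerivAt_const (c : F) (t : K) : HasWeakDerivAt (fun _ => c) 0 t := fun l => by
  simpa using hasDerivAt_const t (l c)

theorem HasWeakDerivAt.smul_const {c : K → K} {c' t : K} (hc : HasDerivAt c c' t) (a : F) :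
    HasWeakDerivAt (fun s => c s • a) (c' • a) t := by
  simpa using HasWeakDerivAt.smul hc (hasWeakDerivAt_const a t)

theorem HasWeakDerivAt.congr_of_eventuallyEq {γ δ : K → F} {γ' : F} {t : K}
    (h : HasWeakDerivAt γ γ' t) (h' : δ =ᶠ[𝓝 t] γ) : HasWeakDerivAt δ γ' t := fun l =>
  (h l).congr_of_eventuallyEq (h'.fun_comp l)

theorem HasWeakDerivAt.shift {γ : K → F} {γ' : F} {t : K}
    (h : HasWeakDerivAt (fun s => γ (t + s)) γ' 0) : HasWeakDerivAt γ γ' t := fun l => by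
  have h0 := h l
  rw [hasDerivAt_iff_tendsto_slope_zero] at h0 ⊢
  simpa using h0

/-- The derivative of `f` along a curve. -/
theorem HasStrictDirDeriv.hasWeakDerivAt {E : Type*} [AddCommGroup E] [Module K E]
    [TopologicalSpace E] {f : E → F} {c q : K → E} {l : F} {t : K}
    (h : HasStrictDirDeriv K f (c t) (q 0) l) (hq : ContinuousAt q 0)
    (hc : ∀ s, c (t + s) = c t + s • q s) : HasWeakDerivAt (fun s => f (c s)) l t := by
  intro a
  rw [hasDerivAt_iff_tendsto_slope_zero]
  have := h.tendsto tendsto_const_nhds (hq.tendsto.mono_left nhdsWithin_le_nhds)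
    (nhdsWithin_le_nhds (a := (0 : K)) (s := {0}ᶜ)) self_mem_nhdsWithin
  refine ((a.continuous.tendsto l).comp this).congr fun s => ?_
  simp [hc]

section Polynormable

variable [PolynormableSpace K F]

/-- Hahn-Banach, applied to `c • v ↦ c * p v` on the line through `v`. It lets a scalar mean value
theorem control a seminorm. -/
theorem exists_functional (p : Seminorm K F) (hp : Continuous p) (v : F) :
    ∃ l : F →L[K] K, ‖l v‖ = p v ∧ ∀ x, ‖l x‖ ≤ p x := by
  by_cases h0 : p v = 0
  · exact ⟨0, by simp [h0], fun x => by simp⟩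
  have hv : v ≠ 0 := by rintro rfl; simp at h0
  set e := LinearEquiv.toSpanNonzeroSingleton K F v hv
  set l₀ : Module.Dual K (K ∙ v) := ((p v : ℝ) : K) • e.symm.toLinearMap with hl₀
  have key : ∀ c : K, l₀ (e c) = ((p v : ℝ) : K) * c := fun c => by
    simp [hl₀, RCLike.real_smul_eq_coe_mul]
  have hcoe : ∀ c : K, ((e c : K ∙ v) : F) = c • v := fun c => by
    simp [e, LinearEquiv.toSpanNonzeroSingleton_apply]
  have hpv : ‖((p v : ℝ) : K)‖ = p v := by
    rw [RCLike.norm_ofReal, abs_of_nonneg (apply_nonneg p v)]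
  obtain ⟨l, hl, hle⟩ := Module.Dual.exists_continuous_extension_of_le_seminorm (K ∙ v) l₀ hp
    (fun x => by
      obtain ⟨c, rfl⟩ := e.surjective x
      rw [key, hcoe, map_smul_eq_mul, norm_mul, hpv, mul_comm])
  refine ⟨l, ?_, hle⟩
  have := hl (e 1)
  rw [hcoe, one_smul, key, mul_one] at this
  rw [this, hpv]

/-- The mean value inequality. -/
theorem seminorm_sub_le_of_hasWeakDerivAt {p : Seminorm K F} (hp : Continuous p) {γ γ' : K → F}
    {t : K} {C : ℝ} (h : ∀ s : K, ‖s‖ ≤ ‖t‖ → HasWeakDerivAt γ (γ' s) s)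
    (hC : ∀ s : K, ‖s‖ ≤ ‖t‖ → p (γ' s) ≤ C) : p (γ t - γ 0) ≤ C * ‖t‖ := by
  -- A functional dominated by `p` and norming `γ t - γ 0` reduces the claim to a scalar function on
  -- the segment `r ↦ r t`, `0 ≤ r ≤ 1`.
  obtain ⟨l, hl, hle⟩ := exists_functional p hp (γ t - γ 0)
  have hr : ∀ r ∈ Icc (0 : ℝ) 1, ‖(r : K) * t‖ ≤ ‖t‖ := by
    intro r hr
    rw [norm_mul, RCLike.norm_ofReal, abs_of_nonneg hr.1]
    exact mul_le_of_le_one_left (norm_nonneg _) hr.2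
  have hd : ∀ r ∈ Icc (0 : ℝ) 1, HasDerivWithinAt (fun r : ℝ => l (γ ((r : K) * t)))
      (t * l (γ' ((r : K) * t))) (Icc 0 1) r := by
    intro r hr'
    have h1 : HasDerivAt (fun r : ℝ => (r : K) * t) t r := by
      simpa using (RCLike.ofRealCLM (K := K)).hasDerivAt (x := r) |>.mul_const t
    exact ((h _ (hr r hr') l).scomp r h1).hasDerivWithinAt
  have := norm_image_sub_le_of_norm_deriv_le_segment_01' hd (C := C * ‖t‖) (by
    intro r hr'
    rw [norm_mul, mul_comm]
    exact mul_le_mul_of_nonneg_right ((hle _).trans (hC _ (hr r (Ico_subset_Icc_self hr'))))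
      (norm_nonneg _))
  simpa [← map_sub, hl] using this

theorem tendsto_nhds_iff_seminorm {α : Type*} {a : Filter α} {g : α → F} {y : F} :
    Tendsto g a (𝓝 y) ↔
      ∀ p : Seminorm K F, Continuous p → ∀ ε, 0 < ε → ∀ᶠ x in a, p (g x - y) < ε := by
  rw [(PolynormableSpace.withSeminorms K F).tendsto_nhds, Subtype.forall]

end Polynormable

/-- Supplies estimates on the whole disc `‖s‖ ≤ ‖T i‖`, as the mean value inequality requires. -/
theorem eventually_forall_norm_le {α : Type*} {a : Filter α} {T : α → K} (hT : Tendsto T a (𝓝 0))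
    {P : α → K → Prop} (h : ∀ᶠ q in a ×ˢ 𝓝 (0 : K), P q.1 q.2) :
    ∀ᶠ i in a, ∀ s : K, ‖s‖ ≤ ‖T i‖ → P i s := by
  obtain ⟨pa, ha, pb, hb, hP⟩ := eventually_prod_iff.1 h
  obtain ⟨ε, hε, hball⟩ := Metric.eventually_nhds_iff.1 hb
  filter_upwards [ha, hT.norm.eventually_lt_const (by simpa using hε)] with i hi hTi s hs
  exact hP hi (hball (by simpa using hs.trans_lt hTi))

theorem eventually_triple_forall_norm_le {E : Type*} [TopologicalSpace E] {x y : E}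
    {P : E × E × K → Prop} (h : ∀ᶠ q in 𝓝 (x, y, (0 : K)), P q) :
    ∀ᶠ q in 𝓝 (x, y, (0 : K)), ∀ s : K, ‖s‖ ≤ ‖q.2.2‖ → P (q.1, q.2.1, s) := by
  refine eventually_forall_norm_le (T := fun q : E × E × K => q.2.2)
    (P := fun q s => P (q.1, q.2.1, s))
    ((continuous_snd.comp continuous_snd).tendsto (x, y, (0 : K))) ?_
  rw [← nhds_prod_eq]
  have : Continuous (fun q : (E × E × K) × K => (q.1.1, q.1.2.1, q.2)) := by fun_prop
  exact (this.tendsto ((x, y, (0 : K)), (0 : K))).eventually h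

section Main

variable [PolynormableSpace K F]


/-- Weak differentiability along all lines with a continuous derivative implies strict
differentiability. -/
theorem hasStrictDirDeriv_of_hasWeakDerivAt {E : Type*} [AddCommGroup E] [Module K E]
    [TopologicalSpace E] [IsTopologicalAddGroup E] [ContinuousSMul K E]
    {O : Set E} (hO : IsOpen O) {h : E → F} {h' : E × E → F} (hc : ContinuousOn h' (O ×ˢ univ))
    (hw : ∀ x ∈ O, ∀ y, HasWeakDerivAt (fun s : K => h (x + s • y)) (h' (x, y)) 0)
    {x : E} (hx : x ∈ O) (y : E) : HasStrictDirDeriv K h x y (h' (x, y)) := by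
  refine (tendsto_nhds_iff_seminorm (K := K)).2 fun p hp ε hε => ?_
  have hcont : Continuous (fun q : E × E × K => (q.1 + q.2.2 • q.2.1, q.2.1)) := by fun_prop
  have t0 : Tendsto (fun q : E × E × K => (q.1 + q.2.2 • q.2.1, q.2.1)) (𝓝 (x, y, 0))
      (𝓝 (x, y)) := by simpa using hcont.tendsto (x, y, (0 : K))
  have hmem : O ×ˢ univ ∈ 𝓝 (x, y) := (hO.prod isOpen_univ).mem_nhds ⟨hx, mem_univ y⟩
  have e1 : ∀ᶠ q in 𝓝 (x, y, (0 : K)), (q.1 + q.2.2 • q.2.1, q.2.1) ∈ O ×ˢ (univ : Set E) :=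
    t0 hmem
  have e2 : ∀ᶠ q in 𝓝 (x, y, (0 : K)),
      p (h' (q.1 + q.2.2 • q.2.1, q.2.1) - h' (x, y)) < ε / 2 :=
    (tendsto_nhds_iff_seminorm (K := K)).1 ((hc.continuousAt hmem).tendsto.comp t0) p hp _
      (half_pos hε)
  have e3 := eventually_triple_forall_norm_le (e1.and e2)
  filter_upwards [nhdsWithin_le_nhds e3, self_mem_nhdsWithin] with q hq hq0
  have hq0 : q.2.2 ≠ 0 := hq0
  -- Subtracting the linear function `s ↦ s • h' (x, y)` leaves a curve whose derivative is small by
  -- continuity of `h'`.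
  have := seminorm_sub_le_of_hasWeakDerivAt hp (t := q.2.2) (C := ε / 2)
    (γ := fun s => h (q.1 + s • q.2.1) - s • h' (x, y))
    (γ' := fun s => h' (q.1 + s • q.2.1, q.2.1) - (1 : K) • h' (x, y))
    (fun s hs => by
      refine HasWeakDerivAt.sub (HasWeakDerivAt.shift ?_)
        (HasWeakDerivAt.smul_const (hasDerivAt_id s) _)
      simpa only [add_smul, add_assoc] using hw _ (hq s hs).1.1 q.2.1)
    (fun s hs => by simpa using (hq s hs).2.le)
  have e : diffQuot K h q - h' (x, y) = q.2.2⁻¹ • (h (q.1 + q.2.2 • q.2.1) - q.2.2 • h' (x, y) -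
      (h (q.1 + (0 : K) • q.2.1) - (0 : K) • h' (x, y))) := by
    rw [diffQuot, eq_inv_smul_iff₀ hq0, smul_sub, smul_inv_smul₀ hq0]
    simp only [zero_smul, add_zero, sub_zero]
    abel
  rw [e, map_smul_eq_mul, norm_inv]
  have h0 : 0 < ‖q.2.2‖ := norm_pos_iff.2 hq0
  calc _ ≤ ‖q.2.2‖⁻¹ * (ε / 2 * ‖q.2.2‖) := by gcongr
    _ = ε / 2 := by field_simp
    _ < ε := half_lt_self hε

/-- The mixed second difference quotients converge to the second derivative. -/
theorem tendsto_second_difference {E : Type u} [AddCommGroup E] [Module K E]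
    [TopologicalSpace E] [IsTopologicalAddGroup E] [ContinuousSMul K E]
    {U : Set E} (hU : IsOpen U) {f : E → F} (hf : IsTSmoothOn K U f) {x : E} (hx : x ∈ U)
    (y x₁ y₁ : E) :
    Tendsto (fun q : K × K => (q.1 * q.2)⁻¹ • (f (x + q.1 • x₁ + q.2 • y + (q.1 * q.2) • y₁) -
      f (x + q.1 • x₁) - f (x + q.2 • y) + f x)) (𝓝[≠] 0 ×ˢ 𝓝[≠] 0)
      (𝓝 (dirDeriv K (dirDeriv K f) ((x, y), (x₁, y₁)))) := by
  refine (tendsto_nhds_iff_seminorm (K := K)).2 fun p hp ε hε => ?_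
  set l := dirDeriv K (dirDeriv K f) ((x, y), (x₁, y₁))
  have hle : (𝓝[≠] (0 : K)) ×ˢ 𝓝[≠] (0 : K) ≤ 𝓝 ((0 : K), (0 : K)) := by
    rw [nhds_prod_eq]; exact prod_mono nhdsWithin_le_nhds nhdsWithin_le_nhds
  have hle' : ((𝓝[≠] (0 : K)) ×ˢ 𝓝[≠] (0 : K)) ×ˢ 𝓝 (0 : K) ≤ 𝓝 (((0 : K), (0 : K)), (0 : K)) := by
    rw [nhds_prod_eq (x := ((0 : K), (0 : K)))]; exact prod_mono hle le_rfl
  have e1 : ∀ᶠ q : (K × K) × K in 𝓝 ((0, 0), 0), q.1.1 ≠ 0 →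
      p (diffQuot K (dirDeriv K f) ((x + q.2 • y, y), (x₁ + q.2 • y₁, y₁), q.1.1) - l) < ε / 2 := by
    have hcont : Continuous (fun q : (K × K) × K =>
        (((x + q.2 • y, y), (x₁ + q.2 • y₁, y₁), q.1.1) : (E × E) × (E × E) × K)) := by fun_prop
    have t0 : Tendsto (fun q : (K × K) × K =>
        (((x + q.2 • y, y), (x₁ + q.2 • y₁, y₁), q.1.1) : (E × E) × (E × E) × K))
        (𝓝 ((0, 0), 0)) (𝓝 ((x, y), (x₁, y₁), 0)) := by
      simpa using hcont.tendsto (((0 : K), (0 : K)), (0 : K))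
    exact t0.eventually (eventually_nhdsWithin_iff.1 ((tendsto_nhds_iff_seminorm (K := K)).1
      (hf.dirDeriv.strict (x := (x, y)) ⟨hx, mem_univ y⟩ (x₁, y₁)) p hp _ (half_pos hε)))
  have e2 : ∀ᶠ q : (K × K) × K in 𝓝 ((0, 0), 0),
      x + q.1.1 • x₁ + q.2 • (y + q.1.1 • y₁) ∈ U := by
    have hcont : Continuous (fun q : (K × K) × K =>
        x + q.1.1 • x₁ + q.2 • (y + q.1.1 • y₁)) := by fun_prop
    exact hcont.tendsto ((0, 0), 0) (hU.mem_nhds (by simpa using hx))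
  have e3 : ∀ᶠ q : (K × K) × K in 𝓝 ((0, 0), 0), x + q.2 • y ∈ U := by
    have hcont : Continuous (fun q : (K × K) × K => x + q.2 • y) := by fun_prop
    exact hcont.tendsto ((0, 0), 0) (hU.mem_nhds (by simpa using hx))
  have e4 := eventually_forall_norm_le (a := 𝓝[≠] (0 : K) ×ˢ 𝓝[≠] (0 : K)) (T := Prod.snd)
    (P := fun q r => (q.1 ≠ 0 →
      p (diffQuot K (dirDeriv K f) ((x + r • y, y), (x₁ + r • y₁, y₁), q.1) - l) < ε / 2) ∧
      x + q.1 • x₁ + r • (y + q.1 • y₁) ∈ U ∧ x + r • y ∈ U)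
    (tendsto_snd.mono_right nhdsWithin_le_nhds) (hle' (e1.and (e2.and e3)))
  filter_upwards [e4, tendsto_fst.eventually (self_mem_nhdsWithin (a := (0 : K))),
    tendsto_snd.eventually (self_mem_nhdsWithin (a := (0 : K)))] with q hq hs0 ht0
  obtain ⟨s, t⟩ := q
  have hs0 : s ≠ 0 := hs0
  have ht0 : t ≠ 0 := ht0
  have hline : ∀ a b : E, ∀ r : K, a + r • b ∈ U →
      HasWeakDerivAt (fun r : K => f (a + r • b)) (dirDeriv K f (a + r • b, b)) r := fun a b r hr =>
    (hf.strict hr b).hasWeakDerivAt (c := fun r => a + r • b) (q := fun _ => b) continuousAt_const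
      fun r' => by module
  -- With `s` frozen, the mean value inequality is applied in the other variable. The derivative in
  -- `r` is `s` times a difference quotient of `df` minus `l`, because `x + s x₁ + r (y + s y₁) = (x
  -- + r y) + s (x₁ + r y₁)`.
  have := seminorm_sub_le_of_hasWeakDerivAt hp (t := t) (C := ‖s‖ * (ε / 2))
    (γ := fun r => f (x + s • x₁ + r • (y + s • y₁)) - f (x + r • y) - r • s • l)
    (γ' := fun r => dirDeriv K f (x + s • x₁ + r • (y + s • y₁), y + s • y₁) -
      dirDeriv K f (x + r • y, y) - (1 : K) • s • l)
    (fun r hr => ((hline _ _ _ (hq r hr).2.1).sub (hline _ _ _ (hq r hr).2.2)).sub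
      (HasWeakDerivAt.smul_const (hasDerivAt_id r) _))
    (fun r hr => by
      have h := ((hq r hr).1 hs0).le
      have e : dirDeriv K f (x + s • x₁ + r • (y + s • y₁), y + s • y₁) -
          dirDeriv K f (x + r • y, y) - (1 : K) • s • l =
          s • (diffQuot K (dirDeriv K f) ((x + r • y, y), (x₁ + r • y₁, y₁), s) - l) := by
        have e' : x + s • x₁ + r • (y + s • y₁) = x + r • y + s • (x₁ + r • y₁) := by module
        rw [diffQuot, smul_sub, smul_inv_smul₀ hs0, one_smul, e']
        rfl
      rw [e, map_smul_eq_mul]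
      gcongr)
  have e : (s * t)⁻¹ • (f (x + s • x₁ + t • y + (s * t) • y₁) -
      f (x + s • x₁) - f (x + t • y) + f x) - l =
      (s * t)⁻¹ • (f (x + s • x₁ + t • (y + s • y₁)) - f (x + t • y) - t • s • l -
        (f (x + s • x₁ + (0 : K) • (y + s • y₁)) - f (x + (0 : K) • y) - (0 : K) • s • l)) := by
    have e' : x + s • x₁ + t • y + (s * t) • y₁ = x + s • x₁ + t • (y + s • y₁) := by module
    rw [eq_inv_smul_iff₀ (mul_ne_zero hs0 ht0), smul_sub, smul_inv_smul₀ (mul_ne_zero hs0 ht0), e']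
    simp only [zero_smul, add_zero, sub_zero]
    rw [smul_smul t s, mul_comm t s]
    abel
  rw [e, map_smul_eq_mul, norm_inv, norm_mul]
  have h0 : 0 < ‖s‖ := norm_pos_iff.2 hs0
  have h1 : 0 < ‖t‖ := norm_pos_iff.2 ht0
  calc _ ≤ (‖s‖ * ‖t‖)⁻¹ * (‖s‖ * (ε / 2) * ‖t‖) := by gcongr
    _ = ε / 2 := by field_simp
    _ < ε := half_lt_self hε

variable [T2Space F]

/-- The symmetry of second derivatives. -/
theorem dirDeriv_dirDeriv_flip {E : Type u} [AddCommGroup E] [Module K E]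
    [TopologicalSpace E] [IsTopologicalAddGroup E] [ContinuousSMul K E]
    {U : Set E} (hU : IsOpen U) {f : E → F} (hf : IsTSmoothOn K U f) {x : E} (hx : x ∈ U)
    (y x₁ y₁ : E) :
    dirDeriv K (dirDeriv K f) ((x, y), (x₁, y₁)) = dirDeriv K (dirDeriv K f) ((x, x₁), (y, y₁)) := by
  -- The mixed second difference is unchanged when `(s, x₁)` and `(t, y)` are exchanged, so both
  -- second derivatives are limits of the same expression.
  refine tendsto_nhds_unique (tendsto_second_difference hU hf hx y x₁ y₁)
    (((tendsto_second_difference hU hf hx x₁ y y₁).comp tendsto_prod_swap).congr fun q => ?_)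
  simp only [Function.comp, Prod.fst_swap, Prod.snd_swap, mul_comm q.2 q.1]
  rw [add_right_comm x (q.2 • y), sub_right_comm]

/-- The derivative of the `n`-th directional derivative. -/
theorem dirDeriv_iterDir (n : ℕ) : ∀ {E : Type u} [AddCommGroup E] [Module K E]
    [TopologicalSpace E] [IsTopologicalAddGroup E] [ContinuousSMul K E]
    {U : Set E} (_ : IsOpen U) {f : E → F} (_ : IsTSmoothOn K U f) {x : E} (_ : x ∈ U)
    (y x₁ y₁ : E), dirDeriv K (iterDir K n f) ((x, y), (x₁, y₁)) =
      iterDir K n (dirDeriv K f) ((x, x₁), (y, y₁)) := by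
  induction n with
  | zero =>
    intro E _ _ _ _ _ U hU f hf x hx y x₁ y₁
    exact congrFun (dirDeriv_comp_clm (K := K) f (ContinuousLinearMap.fst K E E)) ((x, y), (x₁, y₁))
  | succ n ih =>
    intro E _ _ _ _ _ U hU f hf x hx y x₁ y₁
    set A : E × E →L[K] (E × E) × (E × E) := (ContinuousLinearMap.id K (E × E)).prod
      ((ContinuousLinearMap.snd K E E).prod 0)
    have h1 : dirDeriv K (iterDir K (n + 1) f) ((x, y), (x₁, y₁)) =
        dirDeriv K (iterDir K n (dirDeriv K f)) (((x, y), (y, 0)), ((x₁, y₁), (y₁, 0))) :=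
      congrFun (dirDeriv_comp_clm (K := K) (iterDir K n (dirDeriv K f)) A) ((x, y), (x₁, y₁))
    rw [h1, ih (hU.prod isOpen_univ) hf.dirDeriv ⟨hx, mem_univ _⟩, iterDir]
    -- `B` exchanges the two middle entries. Symmetry makes the second derivative of `f` invariant
    -- under `B`, while `B` carries the arguments produced by the induction hypothesis to the
    -- required ones.
    set B : (E × E) × (E × E) →L[K] (E × E) × (E × E) :=
      (((ContinuousLinearMap.fst K E E).comp (ContinuousLinearMap.fst K _ _)).prod
        ((ContinuousLinearMap.fst K E E).comp (ContinuousLinearMap.snd K _ _))).prod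
      (((ContinuousLinearMap.snd K E E).comp (ContinuousLinearMap.fst K _ _)).prod
        ((ContinuousLinearMap.snd K E E).comp (ContinuousLinearMap.snd K _ _)))
    have h2 := iterDir_comp_clm (K := K) n (dirDeriv K (dirDeriv K f)) B
      (((x, y), (x₁, y₁)), ((y, 0), (y₁, 0)))
    refine Eq.trans ?_ h2
    refine iterDir_eqOn_of_eqOn n ((hU.prod isOpen_univ).prod isOpen_univ) ?_
      ⟨⟨⟨hx, mem_univ _⟩, mem_univ _⟩, mem_univ _⟩
    rintro ⟨⟨a, b⟩, ⟨a₁, b₁⟩⟩ ⟨⟨ha, -⟩, -⟩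
    exact dirDeriv_dirDeriv_flip hU hf ha b a₁ b₁

end Main

end LocallyConvex

/-! ### Taylor quotients, and smoothness of `f^[1]`. -/

section Taylor

open scoped Nat

universe u v w

variable {K : Type w} [RCLike K] {F : Type v} [AddCommGroup F] [Module K F] [TopologicalSpace F]

variable (K) in
/-- The remainder of the Taylor expansion of order `n` of `t ↦ f (x + t y)`. -/
noncomputable def taylorRem {E : Type u} [AddCommGroup E] [Module K E] [TopologicalSpace E]
    (n : ℕ) (f : E → F) (q : E × E × K) : F :=
  f (q.1 + q.2.2 • q.2.1) -
    ∑ j ∈ Finset.range n, (q.2.2 ^ j * (j ! : K)⁻¹) • iterDir K j f (q.1, q.2.1)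

open Classical in
variable (K) in
/-- The remainder of the Taylor expansion of order `n` of `t ↦ f (x + t y)`, divided by `t ^ n`. -/
noncomputable def taylorQuot {E : Type u} [AddCommGroup E] [Module K E] [TopologicalSpace E]
    (n : ℕ) (f : E → F) (q : E × E × K) : F :=
  if q.2.2 = 0 then (n ! : K)⁻¹ • iterDir K n f (q.1, q.2.1)
  else (q.2.2 ^ n)⁻¹ • taylorRem K n f q

section Algebra

variable {E : Type u} [AddCommGroup E] [Module K E] [TopologicalSpace E]

theorem taylorRem_succ (n : ℕ) (f : E → F) (q : E × E × K) :
    taylorRem K (n + 1) f q =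
      taylorRem K n f q - (q.2.2 ^ n * (n ! : K)⁻¹) • iterDir K n f (q.1, q.2.1) := by
  simp only [taylorRem, Finset.sum_range_succ]
  abel

theorem taylorQuot_zero_right (n : ℕ) (f : E → F) (x y : E) :
    taylorQuot K n f (x, y, 0) = (n ! : K)⁻¹ • iterDir K n f (x, y) := if_pos rfl

theorem taylorQuot_of_ne {n : ℕ} {f : E → F} {q : E × E × K} (hq : q.2.2 ≠ 0) :
    taylorQuot K n f q = (q.2.2 ^ n)⁻¹ • taylorRem K n f q := if_neg hq

theorem taylorQuot_zero (f : E → F) (q : E × E × K) :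
    taylorQuot K 0 f q = f (q.1 + q.2.2 • q.2.1) := by
  obtain ⟨x, y, t⟩ := q
  by_cases ht : t = 0
  · subst ht
    simp [taylorQuot_zero_right, iterDir]
  · simp [taylorQuot_of_ne (q := (x, y, t)) ht, taylorRem]

/-- At `t = 0` only the term `j = 0` survives and cancels `f x`. The order must be positive, since
at order `0` nothing is subtracted. -/
theorem taylorRem_succ_zero_right (n : ℕ) (f : E → F) (x y : E) :
    taylorRem K (n + 1) f (x, y, 0) = 0 := by
  induction n with
  | zero => simp [taylorRem, iterDir]
  | succ n ih => rw [taylorRem_succ, ih]; simp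

theorem taylorRem_eq (n : ℕ) (f : E → F) (q : E × E × K) :
    taylorRem K n f q = q.2.2 ^ n • taylorQuot K n f q := by
  obtain ⟨x, y, t⟩ := q
  by_cases ht : t = 0
  · subst ht
    cases n with
    | zero => simp [taylorQuot_zero, taylorRem]
    | succ n => simp [taylorRem_succ_zero_right]
  · rw [taylorQuot_of_ne (q := (x, y, t)) ht, smul_inv_smul₀ (pow_ne_zero _ ht)]

theorem taylorQuot_eq (n : ℕ) (f : E → F) (q : E × E × K) :
    taylorQuot K n f q =
      (n ! : K)⁻¹ • iterDir K n f (q.1, q.2.1) + q.2.2 • taylorQuot K (n + 1) f q := by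
  obtain ⟨x, y, t⟩ := q
  by_cases ht : t = 0
  · subst ht
    simp [taylorQuot_zero_right]
  · rw [taylorQuot_of_ne (q := (x, y, t)) ht, taylorQuot_of_ne (q := (x, y, t)) ht, taylorRem_succ]
    simp only [smul_sub, smul_smul]
    have h1 : t * (t ^ (n + 1))⁻¹ = (t ^ n)⁻¹ := by field_simp; ring
    have h2 : t * ((t ^ (n + 1))⁻¹ * (t ^ n * (n ! : K)⁻¹)) = (n ! : K)⁻¹ := by field_simp; ring
    rw [h1, h2]
    abel

end Algebra

theorem hasDerivAt_pow_mul_factorial_inv (n : ℕ) {c : K → K} {c' s : K} (hc : HasDerivAt c c' s) :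
    HasDerivAt (fun s => c s ^ (n + 1) * ((n + 1) ! : K)⁻¹) (c' * (c s ^ n * (n ! : K)⁻¹)) s := by
  have h := (hc.fun_pow (n + 1)).mul_const ((n + 1) ! : K)⁻¹
  refine h.congr_deriv ?_
  have : (n ! : K) ≠ 0 := Nat.cast_ne_zero.2 n.factorial_ne_zero
  have : ((n : K) + 1) ≠ 0 := Nat.cast_add_one_ne_zero n
  rw [Nat.factorial_succ]
  push_cast
  field_simp

section Derivatives

/-- Differentiating `s ^ (j + 1) / (j + 1)!` gives `s ^ j / j!`, and `iterDir K (j + 1) f (x, y)` is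
by definition the `j`-th iterate for `df` at `(x, y)` in the direction `(y, 0)`. So the order drops
by one while `f` becomes `df`. -/
theorem hasWeakDerivAt_taylorRem (n : ℕ) {E : Type u} [AddCommGroup E] [Module K E]
    [TopologicalSpace E] {U : Set E} {f : E → F} (hf : IsTSmoothOn K U f) (x y : E) {s : K}
    (hs : x + s • y ∈ U) :
    HasWeakDerivAt (fun s => taylorRem K (n + 1) f (x, y, s))
      (taylorRem K n (dirDeriv K f) ((x, y), (y, 0), s)) s := by
  induction n with
  | zero =>
    have h1 : HasWeakDerivAt (fun s : K => f (x + s • y)) (dirDeriv K f (x + s • y, y)) s :=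
      (hf.strict hs y).hasWeakDerivAt (c := fun r => x + r • y) (q := fun _ => y)
        continuousAt_const fun r' => by module
    simpa [taylorRem, iterDir] using h1.sub (hasWeakDerivAt_const (f x) s)
  | succ n ih =>
    have := ih.sub (HasWeakDerivAt.smul_const (hasDerivAt_pow_mul_factorial_inv n (hasDerivAt_id s))
      (iterDir K (n + 1) f (x, y)))
    simp only [id, one_mul] at this
    simpa only [taylorRem_succ (n + 1) f, taylorRem_succ n (dirDeriv K f), iterDir] using this

theorem hasWeakDerivAt_id_smul {γ : K → F} (h : ContinuousAt γ 0) :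
    HasWeakDerivAt (fun s => s • γ s) (γ 0) 0 := by
  intro l
  rw [hasDerivAt_iff_tendsto_slope_zero]
  have := (l.continuous.tendsto (γ 0)).comp (h.tendsto.mono_left (nhdsWithin_le_nhds (s := {0}ᶜ)))
  refine this.congr' ?_
  filter_upwards [self_mem_nhdsWithin] with s hs
  have hs : s ≠ 0 := hs
  simp [hs]

variable [PolynormableSpace K F]

/-- Induction on `n`: the remainder of order `n + 1` has derivative `s ^ n` times a Taylor quotient
of `df`, which is continuous at `s = 0` by the induction hypothesis. Integrating this information
and dividing by `t ^ (n + 1)` gives the claim. -/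
theorem continuousAt_taylorQuot_zero (n : ℕ) : ∀ {E : Type u} [AddCommGroup E] [Module K E]
    [TopologicalSpace E] [IsTopologicalAddGroup E] [ContinuousSMul K E] {U : Set E} {f : E → F},
    IsOpen U → IsTSmoothOn K U f → ∀ {x : E}, x ∈ U → ∀ y,
      ContinuousAt (taylorQuot K n f) (x, y, (0 : K)) := by
  induction n with
  | zero =>
    intro E _ _ _ _ _ U f hU hf x hx y
    have hcont : Continuous (fun q : E × E × K => q.1 + q.2.2 • q.2.1) := by fun_prop
    refine ContinuousAt.congr (f := fun q : E × E × K => f (q.1 + q.2.2 • q.2.1)) ?_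
      (Eventually.of_forall fun q => (taylorQuot_zero f q).symm)
    exact ContinuousAt.comp (f := fun q : E × E × K => q.1 + q.2.2 • q.2.1)
      (hf.continuousOn.continuousAt (hU.mem_nhds (by simpa using hx))) hcont.continuousAt
  | succ n ih =>
    intro E _ _ _ _ _ U f hU hf x hx y
    refine (tendsto_nhds_iff_seminorm (K := K)).2 fun p hp ε hε => ?_
    set c := taylorQuot K n (dirDeriv K f) ((x, y), (y, 0), (0 : K)) with hc
    have hn : ((n : K) + 1) ≠ 0 := Nat.cast_add_one_ne_zero n
    have h0 : ∀ x y : E, taylorQuot K (n + 1) f (x, y, 0) =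
        ((n : K) + 1)⁻¹ • taylorQuot K n (dirDeriv K f) ((x, y), (y, 0), (0 : K)) := by
      intro x y
      rw [taylorQuot_zero_right, taylorQuot_zero_right, smul_smul, ← mul_inv, Nat.factorial_succ]
      push_cast
      rfl
    have e1 : ∀ᶠ q : E × E × K in 𝓝 (x, y, 0), p (taylorQuot K n (dirDeriv K f)
        ((q.1, q.2.1), (q.2.1, 0), q.2.2) - c) < ε / 2 := by
      have hcont : Continuous (fun q : E × E × K =>
        (((q.1, q.2.1), (q.2.1, 0), q.2.2) : (E × E) × (E × E) × K)) := by fun_prop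
      exact (hcont.tendsto (x, y, 0)).eventually ((tendsto_nhds_iff_seminorm (K := K)).1
        (ih (hU.prod isOpen_univ) hf.dirDeriv (x := (x, y)) ⟨hx, mem_univ _⟩ (y, 0)) p hp _
          (half_pos hε))
    have e2 : ∀ᶠ q : E × E × K in 𝓝 (x, y, 0), q.1 + q.2.2 • q.2.1 ∈ U := by
      have hcont : Continuous (fun q : E × E × K => q.1 + q.2.2 • q.2.1) := by fun_prop
      exact (hcont.tendsto (x, y, 0)) (hU.mem_nhds (by simpa using hx))
    filter_upwards [eventually_triple_forall_norm_le (e1.and e2)] with q hq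
    obtain ⟨x', y', t⟩ := q
    simp only at hq
    have key : p (taylorQuot K (n + 1) f (x', y', t) - ((n : K) + 1)⁻¹ • c) ≤ ε / 2 := by
      by_cases ht : t = 0
      · subst ht
        rw [h0, ← smul_sub, map_smul_eq_mul]
        have h1 : ‖((n : K) + 1)⁻¹‖ ≤ 1 := by
          rw [norm_inv]
          refine inv_le_one_of_one_le₀ ?_
          have : ((n : K) + 1) = ((n + 1 : ℕ) : K) := by push_cast; rfl
          rw [this, RCLike.norm_natCast]
          exact_mod_cast Nat.succ_pos n
        calc _ ≤ 1 * (ε / 2) := by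
              gcongr
              exact (hq 0 (by simp)).1.le
          _ = ε / 2 := one_mul _
      · have hpos : 0 < ‖t‖ := norm_pos_iff.2 ht
        have := seminorm_sub_le_of_hasWeakDerivAt hp (t := t) (C := ‖t‖ ^ n * (ε / 2))
          (γ := fun s => taylorRem K (n + 1) f (x', y', s) -
            (s ^ (n + 1) * ((n + 1) ! : K)⁻¹) • (n ! : K) • c)
          (γ' := fun s => taylorRem K n (dirDeriv K f) ((x', y'), (y', 0), s) -
            ((1 : K) * (s ^ n * (n ! : K)⁻¹)) • (n ! : K) • c)
          (fun s hs => (hasWeakDerivAt_taylorRem n hf x' y' (hq s hs).2).sub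
            (HasWeakDerivAt.smul_const (hasDerivAt_pow_mul_factorial_inv n (hasDerivAt_id s)) _))
          (fun s hs => by
            have hfac : (n ! : K) ≠ 0 := Nat.cast_ne_zero.2 n.factorial_ne_zero
            rw [taylorRem_eq, smul_smul, one_mul, mul_assoc, inv_mul_cancel₀ hfac, mul_one,
              ← smul_sub, map_smul_eq_mul, norm_pow]
            gcongr
            exact (hq s hs).1.le)
        have e : taylorQuot K (n + 1) f (x', y', t) - ((n : K) + 1)⁻¹ • c =
            (t ^ (n + 1))⁻¹ • (taylorRem K (n + 1) f (x', y', t) -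
              (t ^ (n + 1) * ((n + 1) ! : K)⁻¹) • (n ! : K) • c -
              (taylorRem K (n + 1) f (x', y', 0) -
                ((0 : K) ^ (n + 1) * ((n + 1) ! : K)⁻¹) • (n ! : K) • c)) := by
          have hfac : (n ! : K) ≠ 0 := Nat.cast_ne_zero.2 n.factorial_ne_zero
          rw [taylorRem_succ_zero_right, taylorQuot_of_ne (q := (x', y', t)) ht,
            zero_pow n.succ_ne_zero, zero_mul, zero_smul, sub_zero, sub_zero, smul_sub]
          congr 1
          rw [smul_smul, smul_smul, Nat.factorial_succ]
          push_cast
          congr 1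
          field_simp
        rw [e, map_smul_eq_mul, norm_inv, norm_pow]
        calc _ ≤ (‖t‖ ^ (n + 1))⁻¹ * (‖t‖ ^ n * (ε / 2) * ‖t‖) := by gcongr
          _ = ε / 2 := by field_simp; ring
    rw [h0]
    exact key.trans_lt (half_lt_self hε)

variable [IsTopologicalAddGroup F] [ContinuousSMul K F] [T2Space F]

theorem continuousOn_taylorQuot (n : ℕ) {E : Type u} [AddCommGroup E] [Module K E]
    [TopologicalSpace E] [IsTopologicalAddGroup E] [ContinuousSMul K E] {U : Set E} {f : E → F}
    (hU : IsOpen U) (hf : IsTSmoothOn K U f) : ContinuousOn (taylorQuot K n f) (domOne K U) := by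
  rintro ⟨x, y, t⟩ hq
  refine ContinuousAt.continuousWithinAt ?_
  by_cases ht : t = 0
  · subst ht
    exact continuousAt_taylorQuot_zero n hU hf hq.1 y
  have ht' : ∀ᶠ q : E × E × K in 𝓝 (x, y, t), q.2.2 ≠ 0 :=
    (continuous_snd.comp continuous_snd).continuousAt.eventually_ne ht
  have hcont : Continuous (fun q : E × E × K => q.1 + q.2.2 • q.2.1) := by fun_prop
  have c1 : ContinuousOn (taylorRem K n f) (domOne K U) := by
    refine ContinuousOn.sub (hf.continuousOn.comp hcont.continuousOn fun q hq => hq.2)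
      (continuousOn_finsetSum _ fun j _ => ContinuousOn.smul (by fun_prop) ?_)
    exact (hf.iterDir j).continuousOn.comp (f := fun q : E × E × K => (q.1, q.2.1)) (by fun_prop)
      fun q hq => ⟨hq.1, mem_univ _⟩
  have c2 : ContinuousAt (fun q : E × E × K => (q.2.2 ^ n)⁻¹) (x, y, t) :=
    ContinuousAt.inv₀ (by fun_prop) (pow_ne_zero n ht)
  refine (c2.smul (c1.continuousAt ((isOpen_domOne hU).mem_nhds hq))).congr ?_
  filter_upwards [ht'] with q hq
  exact (taylorQuot_of_ne hq).symm

/-- The derivative of the Taylor remainder along a line. -/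
theorem hasWeakDerivAt_taylorRem_line (n : ℕ) {E : Type u} [AddCommGroup E] [Module K E]
    [TopologicalSpace E] [IsTopologicalAddGroup E] [ContinuousSMul K E] {U : Set E} {f : E → F}
    (hU : IsOpen U) (hf : IsTSmoothOn K U f) {x y : E} {t : K} (hx : x ∈ U) (hxt : x + t • y ∈ U)
    (x₁ y₁ : E) (t₁ : K) :
    HasWeakDerivAt (fun s : K => taylorRem K (n + 1) f ((x, y, t) + s • (x₁, y₁, t₁)))
      (taylorRem K (n + 1) (dirDeriv K f) ((x, x₁), (y, y₁), t) +
        t₁ • taylorRem K n (dirDeriv K f) ((x, y), (y, 0), t)) 0 := by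
  have hlin : HasDerivAt (fun s : K => t + s * t₁) t₁ 0 := by
    simpa using ((hasDerivAt_id (0 : K)).mul_const t₁).const_add t
  have hstep : ∀ j, HasWeakDerivAt (fun s : K => iterDir K j f (x + s • x₁, y + s • y₁))
      (iterDir K j (dirDeriv K f) ((x, x₁), (y, y₁))) 0 := by
    intro j
    have h := (hf.iterDir j).strict (x := (x, y)) ⟨hx, mem_univ _⟩ (x₁, y₁)
    rw [dirDeriv_iterDir j hU hf hx] at h
    exact HasStrictDirDeriv.hasWeakDerivAt (c := fun s : K => (x + s • x₁, y + s • y₁))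
      (q := fun _ => (x₁, y₁)) (by simpa using h) continuousAt_const fun s => by simp
  induction n with
  | zero =>
    have h1 := hf.strict hxt (x₁ + t • y₁ + t₁ • y)
    have h2 : dirDeriv K f (x + t • y, x₁ + t • y₁ + t₁ • y) =
        dirDeriv K f (x + t • y, x₁ + t • y₁) + t₁ • dirDeriv K f (x + t • y, y) := by
      rw [((hf.strict hxt (x₁ + t • y₁)).add_direction (hf.strict hxt (t₁ • y))).dirDeriv_eq,
        dirDeriv_smul_right t₁ (hf.strict hxt y)]
    rw [h2] at h1
    -- The curve is quadratic in `s`; its second-order part is put into the varying direction `q`,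
    -- which is harmless for a strict derivative.
    have h3 : HasWeakDerivAt (fun s : K => f (x + s • x₁ + (t + s * t₁) • (y + s • y₁)))
        (dirDeriv K f (x + t • y, x₁ + t • y₁) + t₁ • dirDeriv K f (x + t • y, y)) 0 :=
      HasStrictDirDeriv.hasWeakDerivAt (c := fun s : K => x + s • x₁ + (t + s * t₁) • (y + s • y₁))
        (q := fun s => x₁ + t • y₁ + t₁ • y + (s * t₁) • y₁) (by simpa using h1)
        (by fun_prop) fun s => by simp only [zero_add, zero_smul, zero_mul, add_zero]; module
    have := h3.sub (hstep 0)
    simp only [taylorRem, zero_add, Finset.sum_range_one, Finset.sum_range_zero, pow_zero,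
      Nat.factorial_zero, Nat.cast_one, inv_one, mul_one, one_smul, sub_zero, 
      smul_eq_mul, Prod.smul_mk, Prod.mk_add_mk,
      smul_zero, add_zero]
    refine HasWeakDerivAt.congr_deriv this ?_
    abel
  | succ n ih =>
    have := ih.sub (HasWeakDerivAt.smul (hasDerivAt_pow_mul_factorial_inv n hlin) (hstep (n + 1)))
    simp only [zero_smul, zero_mul, add_zero] at this
    simp only [taylorRem_succ (n + 1), taylorRem_succ n (dirDeriv K f)] at this ⊢
    refine HasWeakDerivAt.congr_deriv this ?_
    rw [show iterDir K (n + 1) f (x, y) = iterDir K n (dirDeriv K f) ((x, y), (y, 0)) from rfl]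
    module

/-- The derivative of the Taylor quotient along a line. -/
theorem hasWeakDerivAt_taylorQuot_line (n : ℕ) {E : Type u} [AddCommGroup E] [Module K E]
    [TopologicalSpace E] [IsTopologicalAddGroup E] [ContinuousSMul K E] {U : Set E} {f : E → F}
    (hU : IsOpen U) (hf : IsTSmoothOn K U f) {x y : E} {t : K} (hq : (x, y, t) ∈ domOne K U)
    (x₁ y₁ : E) (t₁ : K) :
    HasWeakDerivAt (fun s : K => taylorQuot K (n + 1) f ((x, y, t) + s • (x₁, y₁, t₁)))
      (taylorQuot K (n + 1) (dirDeriv K f) ((x, x₁), (y, y₁), t) +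
        t₁ • (taylorQuot K (n + 1) (dirDeriv K f) ((x, y), (y, 0), t) +
          (-((n : K) + 1)) • taylorQuot K (n + 2) f (x, y, t))) 0 := by
  have hfac : (n ! : K) ≠ 0 := Nat.cast_ne_zero.2 n.factorial_ne_zero
  have hn : ((n : K) + 1) ≠ 0 := Nat.cast_add_one_ne_zero n
  have hn2 : ((n : K) + 1 + 1) ≠ 0 := by
    have := Nat.cast_add_one_ne_zero (R := K) (n + 1)
    push_cast at this
    exact this
  by_cases ht : t = 0
  · subst ht
    have h := (hf.iterDir (n + 1)).strict (x := (x, y)) ⟨hq.1, mem_univ _⟩ (x₁, y₁)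
    rw [dirDeriv_iterDir (n + 1) hU hf hq.1] at h
    have h1 : HasWeakDerivAt (fun s : K => iterDir K (n + 1) f (x + s • x₁, y + s • y₁))
        (iterDir K (n + 1) (dirDeriv K f) ((x, x₁), (y, y₁))) 0 :=
      HasStrictDirDeriv.hasWeakDerivAt (c := fun s : K => (x + s • x₁, y + s • y₁))
        (q := fun _ => (x₁, y₁)) (by simpa using h) continuousAt_const fun s => by simp
    -- At `t = 0`, `taylorQuot_eq` splits off `s t₁` times the quotient of order `n + 2`.
    -- Differentiating such a product at `s = 0` needs only continuity of that quotient.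
    have h2 : ContinuousAt (fun s : K =>
        t₁ • taylorQuot K (n + 2) f ((x, y, 0) + s • (x₁, y₁, t₁))) 0 := by
      have hc : Continuous (fun s : K => (x, y, (0 : K)) + s • (x₁, y₁, t₁)) := by fun_prop
      have hz : ContinuousAt (taylorQuot K (n + 2) f) ((x, y, (0 : K)) + (0 : K) • (x₁, y₁, t₁)) := by
        simpa using continuousAt_taylorQuot_zero (K := K) (n + 2) hU hf hq.1 y
      exact (ContinuousAt.comp (f := fun s : K => (x, y, (0 : K)) + s • (x₁, y₁, t₁)) hz
        hc.continuousAt).const_smul t₁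
    have h3 := HasWeakDerivAt.smul (hasDerivAt_const (0 : K) ((n + 1) ! : K)⁻¹) h1
    have h4 := (h3.add (hasWeakDerivAt_id_smul h2)).congr_of_eventuallyEq
      (δ := fun s : K => taylorQuot K (n + 1) f ((x, y, 0) + s • (x₁, y₁, t₁)))
      (Eventually.of_forall fun s => by
        simp only [taylorQuot_eq (n + 1) f]
        simp [smul_smul])
    refine h4.congr_deriv ?_
    simp only [zero_smul, zero_add, add_zero, taylorQuot_zero_right]
    rw [show iterDir K (n + 2) f (x, y) = iterDir K (n + 1) (dirDeriv K f) ((x, y), (y, 0)) from rfl,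
      Nat.factorial_succ (n + 1), Nat.factorial_succ n]
    push_cast
    congr 2
    rw [smul_smul, ← add_smul]
    congr 1
    field_simp
    ring
  · have hpow : HasDerivAt (fun s : K => ((t + s * t₁) ^ (n + 1))⁻¹)
        (-(((n : K) + 1) * t₁) * (t ^ (n + 2))⁻¹) 0 := by
      have hlin : HasDerivAt (fun s : K => t + s * t₁) t₁ 0 := by
        simpa using ((hasDerivAt_id (0 : K)).mul_const t₁).const_add t
      have := (hlin.fun_pow (n + 1)).fun_inv (by simpa using ht)
      refine this.congr_deriv ?_
      simp only [zero_mul, add_zero, Nat.add_sub_cancel]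
      push_cast
      field_simp
      ring
    have hS := HasWeakDerivAt.smul hpow (hasWeakDerivAt_taylorRem_line n hU hf hq.1 hq.2 x₁ y₁ t₁)
    have hev : ∀ᶠ s : K in 𝓝 0, t + s * t₁ ≠ 0 := by
      have hc : Continuous (fun s : K => t + s * t₁) := by fun_prop
      exact hc.continuousAt.eventually_ne (by simpa using ht)
    have := hS.congr_of_eventuallyEq
      (δ := fun s : K => taylorQuot K (n + 1) f ((x, y, t) + s • (x₁, y₁, t₁))) (by
        filter_upwards [hev] with s hs
        exact taylorQuot_of_ne (q := (x, y, t) + s • (x₁, y₁, t₁)) hs)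
    refine this.congr_deriv ?_
    -- Expanding both remainders by one more order makes the singular terms `t⁻¹ • a` cancel. This
    -- is why order `n + 2` appears: the formula stays continuous across `t = 0`.
    rw [taylorQuot_of_ne (q := ((x, x₁), (y, y₁), t)) ht,
      taylorQuot_of_ne (q := ((x, y), (y, (0 : E)), t)) ht,
      taylorQuot_of_ne (q := (x, y, t)) ht, taylorRem_succ (n + 1) f,
      taylorRem_succ n (dirDeriv K f) ((x, y), (y, 0), t)]
    simp only [zero_smul, zero_mul, add_zero]
    rw [show iterDir K (n + 1) f (x, y) = iterDir K n (dirDeriv K f) ((x, y), (y, 0)) from rfl,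
      Nat.factorial_succ n]
    push_cast
    generalize iterDir K n (dirDeriv K f) ((x, y), (y, 0)) = a
    generalize taylorRem K n (dirDeriv K f) ((x, y), (y, 0), t) = b
    generalize taylorRem K (n + 1) (dirDeriv K f) ((x, x₁), (y, y₁), t) = c
    generalize taylorRem K (n + 1) f (x, y, t) = d
    match_scalars <;> field_simp
    ring

/-- The derivative of a quotient involves quotients of `df` and one of `f` of the next higher order.
The induction on the class `k` therefore runs over all orders and all smooth maps at once. The
derivative found along lines is continuous, so weak differentiability upgrades to strict. -/
theorem isTSmoothOn_taylorQuot {E : Type u} [AddCommGroup E] [Module K E]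
    [TopologicalSpace E] [IsTopologicalAddGroup E] [ContinuousSMul K E] {U : Set E} {f : E → F}
    (hU : IsOpen U) (hf : IsTSmoothOn K U f) (n : ℕ) :
    IsTSmoothOn K (domOne K U) (taylorQuot K (n + 1) f) := by
  have aux : ∀ (k : ℕ) {E : Type u} [AddCommGroup E] [Module K E]
      [TopologicalSpace E] [IsTopologicalAddGroup E] [ContinuousSMul K E] {U : Set E} {f : E → F}
      (_ : IsOpen U) (_ : IsTSmoothOn K U f) (n : ℕ),
      IsTCkOn K k (domOne K U) (taylorQuot K (n + 1) f) := by
    intro k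
    induction k with
    | zero => intro E _ _ _ _ _ U f hU hf n; exact continuousOn_taylorQuot _ hU hf
    | succ k ih =>
      intro E _ _ _ _ _ U f hU hf n
      have hD := isOpen_domOne (K := K) hU
      have hD' := hD.prod (isOpen_univ (X := E × E × K))
      set X := (E × E × K) × (E × E × K)
      let x : X →L[K] E := (ContinuousLinearMap.fst K E (E × K)).comp (ContinuousLinearMap.fst K _ _)
      let yt : X →L[K] E × K :=
        (ContinuousLinearMap.snd K E (E × K)).comp (ContinuousLinearMap.fst K _ _)
      let y : X →L[K] E := (ContinuousLinearMap.fst K E K).comp yt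
      let t : X →L[K] K := (ContinuousLinearMap.snd K E K).comp yt
      let x₁ : X →L[K] E := (ContinuousLinearMap.fst K E (E × K)).comp (ContinuousLinearMap.snd K _ _)
      let yt₁ : X →L[K] E × K :=
        (ContinuousLinearMap.snd K E (E × K)).comp (ContinuousLinearMap.snd K _ _)
      let y₁ : X →L[K] E := (ContinuousLinearMap.fst K E K).comp yt₁
      let t₁ : X →L[K] K := (ContinuousLinearMap.snd K E K).comp yt₁
      have hd := ih (hU.prod isOpen_univ) hf.dirDeriv n
      have c1 : IsTCkOn K k (domOne K U ×ˢ (univ : Set (E × E × K)))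
          (taylorQuot K (n + 1) (dirDeriv K f) ∘ ((x.prod x₁).prod ((y.prod y₁).prod t))) :=
        (hd.comp_clm _).mono fun q hq => ⟨⟨hq.1.1, mem_univ _⟩, ⟨hq.1.2, mem_univ _⟩⟩
      have c2 : IsTCkOn K k (domOne K U ×ˢ (univ : Set (E × E × K)))
          (taylorQuot K (n + 1) (dirDeriv K f) ∘ ((x.prod y).prod ((y.prod 0).prod t))) :=
        (hd.comp_clm _).mono fun q hq => ⟨⟨hq.1.1, mem_univ _⟩, ⟨hq.1.2, mem_univ _⟩⟩
      have c3 : IsTCkOn K k (domOne K U ×ˢ (univ : Set (E × E × K)))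
          (taylorQuot K (n + 2) f ∘ (x.prod (y.prod t))) :=
        ((ih hU hf (n + 1)).comp_clm _).mono fun q hq => hq.1
      have c4 : IsTCkOn K k (domOne K U ×ˢ (univ : Set (E × E × K))) t₁ :=
        (IsTCkOn.clm t₁).mono (subset_univ _)
      have hH := c1.add (c4.smul (c2.add (c3.const_smul (-((n : K) + 1)) hD') hD') hD') hD'
      refine IsTCkOn.succ_of_hasStrictDirDeriv hD (continuousOn_taylorQuot _ hU hf) ?_ hH
      intro q hq v
      exact hasStrictDirDeriv_of_hasWeakDerivAt hD hH.continuousOn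
        (fun q hq v => hasWeakDerivAt_taylorQuot_line n hU hf hq v.1 v.2.1 v.2.2) hq v
  exact fun k => aux k hU hf n

theorem isDiffQuotient_taylorQuot {E : Type u} [AddCommGroup E] [Module K E]
    [TopologicalSpace E] [IsTopologicalAddGroup E] [ContinuousSMul K E] {U : Set E} {f : E → F}
    (hU : IsOpen U) (hf : IsTSmoothOn K U f) : IsDiffQuotient U f (taylorQuot K 1 f) := by
  refine ⟨continuousOn_taylorQuot 1 hU hf, fun x y t _ ht => ?_⟩
  rw [taylorQuot_of_ne (q := (x, y, t)) ht]
  simp [taylorRem, iterDir]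

/-- In locally convex spaces, iterated strict differentiability implies `C^k`. -/
theorem IsTSmoothOn.isCkOn {E : Type u} [AddCommGroup E] [Module K E]
    [TopologicalSpace E] [IsTopologicalAddGroup E] [ContinuousSMul K E] {U : Set E} {f : E → F}
    (hf : IsTSmoothOn K U f) (hU : IsOpen U) (k : ℕ) : IsCkOn K k U f := by
  -- As for `IsCkOn.comp_clm`, the induction lives in the universe `max u w`. It works with fully
  -- smooth maps, since `f^[1]` is again of that kind.
  have aux : ∀ (k : ℕ) {E : Type (max u w)} [AddCommGroup E] [Module K E] [TopologicalSpace E]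
      [IsTopologicalAddGroup E] [ContinuousSMul K E] {U : Set E} {f : E → F}
      (_ : IsTSmoothOn K U f) (_ : IsOpen U), IsCkOn K k U f := by
    intro k
    induction k with
    | zero => intro E _ _ _ _ _ U f hf hU; exact hf.continuousOn
    | succ k ih =>
      intro E _ _ _ _ _ U f hf hU
      exact (isCkOn_succ K k U f).2 ⟨hf.continuousOn, _, isDiffQuotient_taylorQuot hU hf,
        ih (isTSmoothOn_taylorQuot hU hf 0) (isOpen_domOne hU)⟩
  cases k with
  | zero => exact hf.continuousOn
  | succ k =>
    exact (isCkOn_succ K k U f).2 ⟨hf.continuousOn, _, isDiffQuotient_taylorQuot hU hf,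
      aux k (isTSmoothOn_taylorQuot hU hf 0) (isOpen_domOne hU)⟩

end Derivatives

end Taylor

theorem neBot_nhdsNE_zero_of_not_discreteTopology {K : Type*} [AddGroup K] [TopologicalSpace K]
    [ContinuousAdd K] (h : ¬ DiscreteTopology K) : (𝓝[≠] (0 : K)).NeBot := by
  rw [neBot_iff]
  intro h0
  exact h (discreteTopology_of_isOpen_singleton_zero (isOpen_singleton_iff_punctured_nhds 0 |>.2 h0))

end TVSLie

theorem mainTheorem3 :
    -- a homomorphism that is feebly differentiable at `1` is `C^1`, over any topological field
    (∀ (K : Type*) [Field K] [TopologicalSpace K] [IsTopologicalDivisionRing K] [T2Space K]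
      (_ : ¬ DiscreteTopology K)
      (E : Type*) [AddCommGroup E] [Module K E] [TopologicalSpace E] [IsTopologicalAddGroup E]
      [ContinuousSMul K E] [T2Space E]
      (F : Type*) [AddCommGroup F] [Module K F] [TopologicalSpace F] [IsTopologicalAddGroup F]
      [ContinuousSMul K F] [T2Space F]
      (G : Type*) [Group G] [TopologicalSpace G] [ChartedSpace E G] [TVSLie.LieGroupOver K E G]
      (H : Type*) [Group H] [TopologicalSpace H] [ChartedSpace F H] [TVSLie.LieGroupOver K F H]
      (f : G →* H), TVSLie.MFeeblyDifferentiableAt K E F f 1 → TVSLie.IsCkMap K E F 1 f) ∧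
    -- over a valued field, total differentiability at `1` suffices
    (∀ (K : Type*) [NontriviallyNormedField K]
      (E : Type*) [AddCommGroup E] [Module K E] [TopologicalSpace E] [IsTopologicalAddGroup E]
      [ContinuousSMul K E] [T2Space E]
      (F : Type*) [AddCommGroup F] [Module K F] [TopologicalSpace F] [IsTopologicalAddGroup F]
      [ContinuousSMul K F] [T2Space F]
      (G : Type*) [Group G] [TopologicalSpace G] [ChartedSpace E G] [TVSLie.LieGroupOver K E G]
      (H : Type*) [Group H] [TopologicalSpace H] [ChartedSpace F H] [TVSLie.LieGroupOver K F H]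
      (f : G →* H), TVSLie.MTotallyDifferentiableAt K E F f 1 →
        TVSLie.MFeeblyDifferentiableAt K E F f 1 ∧ TVSLie.IsCkMap K E F 1 f) ∧
    -- over `ℝ` or `ℂ`, with `H` modelled on a locally convex space, `f` is `C^∞`
    (∀ (K : Type*) [RCLike K]
      (E : Type*) [AddCommGroup E] [Module K E] [TopologicalSpace E] [IsTopologicalAddGroup E]
      [ContinuousSMul K E] [T2Space E]
      (F : Type*) [AddCommGroup F] [Module K F] [TopologicalSpace F] [IsTopologicalAddGroup F]
      [ContinuousSMul K F] [T2Space F] [PolynormableSpace K F]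
      (G : Type*) [Group G] [TopologicalSpace G] [ChartedSpace E G] [TVSLie.LieGroupOver K E G]
      (H : Type*) [Group H] [TopologicalSpace H] [ChartedSpace F H] [TVSLie.LieGroupOver K F H]
      (f : G →* H),
      TVSLie.MFeeblyDifferentiableAt K E F f 1 ∨ TVSLie.MTotallyDifferentiableAt K E F f 1 →
        ∀ k : ℕ, TVSLie.IsCkMap K E F k f) := by
  refine ⟨?_, ?_, ?_⟩
  · intro K _ _ _ _ hK E _ _ _ _ _ _ F _ _ _ _ _ _ G _ _ _ _ H _ _ _ _ f hf
    have := TVSLie.neBot_nhdsNE_zero_of_not_discreteTopology hK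
    exact hf.isCkMap_one
  · intro K _ E _ _ _ _ _ _ F _ _ _ _ _ _ G _ _ _ _ H _ _ _ _ f hf
    exact ⟨hf.mFeeblyDifferentiableAt, hf.mFeeblyDifferentiableAt.isCkMap_one⟩
  · intro K _ E _ _ _ _ _ _ F _ _ _ _ _ _ _ G _ _ _ _ H _ _ _ _ f hf k
    have hf : TVSLie.MFeeblyDifferentiableAt K E F f 1 :=
      hf.elim id TVSLie.MTotallyDifferentiableAt.mFeeblyDifferentiableAt
    have hc := hf.isCkMap_one.1
    exact ⟨hc, fun φ ψ hφ hψ => TVSLie.IsTSmoothOn.isCkOn (fun n => hf.isTCkOn hφ hψ n)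
      (TVSLie.isOpen_repDomain hc) k⟩
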